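/- **Setting.** Let $d\ge 0$, $m\ge 0$, let $(\Omega,\mathcal A,P)$ be a probability space, $x_0\in\mathbb R^d$, and let $g_0,\dots,g_m:\mathbb R^d\to\mathbb R^d$ be $C^\infty$. Let $T$ be the set of rooted (unordered) trees with vertices coloured by $0,\dots,m$, including the empty tree $\emptyset$; $[\tau_1,\dots,\tau_\kappa]_l$ is the tree obtained by joining nonempty trees $\tau_1,\dots,\tau_\kappa$ to a common root of colour $l$, $\bullet_l$ is the one-vertex tree (the case $\kappa=0$), and $|\tau|$ is the number of vertices. Put $F(\emptyset)(x)=x$, $F(\bullet_l)=g_l$, $F([\tau_1,\dots,\tau_\kappa]_l)(x)=g_l^{(\kappa)}(x)\big(F(\tau_1)(x),\dots,F(\tau_\kappa)(x)\big)$; and $\alpha(\emptyset)=\alpha(\bullet_l)=1$, $\alpha([\tau_1,\dots,\tau_\kappa]_l)=\frac1{r_1!\cdots r_q!}\prod_j\alpha(\tau_j)$, where $r_1,\dots,r_q$ count equal trees among the $\tau_j$. A weight function $\phi$ assigns to each $\tau\in T$ a family of real random variables $(\phi(\tau)(h))_{h\ge0}$. Its B-series is the formal series $$B(\phi,x;h)=\sum_{\tau\in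 T}\alpha(\tau)\,\phi(\tau)(h)\,F(\tau)(x),$$ graded by $|\tau|$: the component of degree $n$ is the sum over $|\tau|=n$. If $Y=x_0+Y_1+Y_2+\cdots$ is a formal series with components in $\mathbb R^d$, then $B(\phi,Y;h)$ is formed by substituting $Y$ into the Taylor series of each $F(\tau)$ at $x_0$. For $\tau\in T$ let $ST(\tau)$ be the set of pairs $(\vartheta,\omega)$ of a subtree $\vartheta$ sharing the root with $\tau$ and the multiset $\omega$ of trees left over: $ST(\emptyset)=\{(\emptyset,\emptyset)\}$, and $ST([\tau_1,\dots,\tau_\kappa]_l)$ consists of $(\emptyset,\{\tau\})$ and of all $([\vartheta_1,\dots,\vartheta_\kappa]_l,\ \omega_1\cup\dots\cup\omega_\kappa)$ with $(\vartheta_j,\omega_j)\in ST(\tau_j)$, empty $\vartheta_j$ being discarded. Put $\gamma(\emptyset,\emptyset,\emptyset)=\gamma(\tau,\emptyset,\{\tau\})=1$ and otherwise $$\gamma(\tau,\vartheta,\omega)=\sum_D\frac{R_1!\cdots R_Q!}{\mu_1!\cdots\mu_p!}\prod_{(\tau',\vartheta',\omega')\in D}\gamma(\tau',\vartheta',\omega'),$$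 where $D$ runs over the distinct multisets of triples $(\tau_j,\vartheta_j,\omega_j)$, one for each branch $\tau_j$ of $\tau$, with $(\vartheta_j,\omega_j)\in ST(\tau_j)$, that produce $(\vartheta,\omega)$; the $R_i$ are the multiplicities of the branches of $\tau$ and the $\mu_i$ those of the triples in $D$. Put $$(\phi_x\circ\phi_y)(\tau)=\sum_{(\vartheta,\omega)\in ST(\tau)}\gamma(\tau,\vartheta,\omega)\,\phi_y(\vartheta)\prod_{\delta\in\omega}\phi_x(\delta).$$ Let $\Phi_{ex},\Phi_{im},\Phi_0$ be weight functions with $\Phi_{ex}(\emptyset)\equiv1$, $\Phi_{im}(\emptyset)\equiv0$, $\Phi_0(\emptyset)\equiv1$, and define $$\Phi_{k+1}(\emptyset)\equiv1,\qquad \Phi_{k+1}(\tau)=\Phi_{ex}(\tau)+(\Phi_k\circ\Phi_{im})(\tau)\quad(\tau\ne\emptyset,\ k\ge 0).$$ **Lemma (simple iteration).** 1. Every $\Phi_k$ is a weight function (its values are random variables). 2. If $Y_{1,0}=B(\Phi_0,x_0;h)$ and $Y_{1,k+1}=B(\Phi_{ex},x_0;h)+B(\Phi_{im},Y_{1,k};h)$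 for $k\ge0$, then $Y_{1,k}=B(\Phi_k,x_0;h)$ for all $k\ge0$, as formal series. 3. The same holds for the actual vectors in $\mathbb R^d$ when the series converge: suppose that the $g_l$ are real analytic on $\mathbb R^d$, and that for given $h$, given $\omega\in\Omega$ and given $K$ the following series converge absolutely: $B(\Phi_{ex},x_0;h)$; $B(\Phi_k,x_0;h)$ for $k\le K$; and, for $k<K$, the composed series $B(\Phi_{im},B(\Phi_k,x_0;h);h)$, expanded as the multiple series with terms $\alpha(\vartheta)\Phi_{im}(\vartheta)\frac1{\kappa!}F(\vartheta)^{(\kappa)}(x_0)\big(v(\delta_1),\dots,v(\delta_\kappa)\big)$, $v(\delta)=\alpha(\delta)\Phi_k(\delta)F(\delta)(x_0)$, over $\vartheta\in T$, $\kappa\ge0$, $\delta_1,\dots,\delta_\kappa\in T\setminus\{\emptyset\}$. Then the vectors $Y_{1,k}$ defined by the recursion in 2 from the sums of the series satisfy $Y_{1,K}=B(\Phi_K,x_0;h)$. 4. There is exactly one weight function $\Phi$ with $\Phi(\emptyset)\equiv1$ and $\Phi(\tau)=\Phi_{ex}(\tau)+(\Phi\circ\Phi_{im})(\tau)$ for all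 $\tau\in T$. The height $$\mathfrak h(\emptyset)=0,\qquad\mathfrak h(\bullet_l)=1,\qquad\mathfrak h([\tau_1,\dots,\tau_\kappa]_l)=1+\max_{1\le j\le\kappa}\mathfrak h(\tau_j)$$ is the corresponding growth function: for every $k\ge0$, if $\Phi_k(\tau)=\Phi(\tau)$ for all $\tau\in T$ with $\mathfrak h(\tau)\le k$, then $\Phi_{k+1}(\tau)=\Phi(\tau)$ for all $\tau\in T$ with $\mathfrak h(\tau)\le k+1$. 5. This is sharp in general: for the given $m$ and $\Omega$ there are weight functions $\Phi_{ex},\Phi_{im},\Phi_0$ as above for which $\Phi_k(\tau)\ne\Phi(\tau)$ whenever $k<\mathfrak h(\tau)$. -/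

import Mathlib

open scoped NNReal

namespace StochB

/-! ### Coloured rooted trees -/

/-- Ordered (plane) rooted trees whose vertices carry a colour in `{0, …, m}`. -/
inductive OTree (m : ℕ) : Type
  | node (l : Fin (m + 1)) (ts : List (OTree m)) : OTree m

namespace OTree

variable {m : ℕ}

/-- The number of vertices. -/
def size : OTree m → ℕ
  | node _ ts => 1 + (ts.map size).sum

/-- Elementary moves that do not change the underlying unordered tree: permuting the branches at
some vertex. -/
inductive Step : OTree m → OTree m → Prop
  | perm (l : Fin (m + 1)) {ts us : List (OTree m)} (h : ts.Perm us) :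
      Step (node l ts) (node l us)
  | congr (l : Fin (m + 1)) (as bs : List (OTree m)) {t u : OTree m} (h : Step t u) :
      Step (node l (as ++ t :: bs)) (node l (as ++ u :: bs))

theorem size_eq_of_step {t u : OTree m} (h : Step t u) : t.size = u.size := by
  induction h with
  | perm l h => simp only [size]; rw [(h.map size).sum_eq]
  | congr l as bs h ih => simp [size, ih]

end OTree

/-- Nonempty (unordered) rooted trees with vertices coloured by `{0, …, m}`: ordered trees up to
permutations of the branches. -/
def NTree (m : ℕ) : Type := Quot (OTree.Step (m := m))

/-- The set `T` of all coloured rooted trees; `none` is the empty tree. -/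
abbrev T (m : ℕ) : Type := Option (NTree m)

namespace NTree

variable {m : ℕ}

noncomputable instance : DecidableEq (NTree m) := Classical.decEq _

/-- The unordered tree underlying an ordered tree. -/
def mk (t : OTree m) : NTree m := Quot.mk _ t

/-- Some ordering of an unordered tree. -/
noncomputable def out (τ : NTree m) : OTree m := Quot.out τ

theorem mk_out (τ : NTree m) : mk (out τ) = τ := Quot.out_eq τ

theorem exists_mk (τ : NTree m) : ∃ t, mk t = τ := ⟨out τ, mk_out τ⟩

theorem sound {t u : OTree m} (h : OTree.Step t u) : mk t = mk u := Quot.sound h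

/-- The number of vertices. -/
def size : NTree m → ℕ := Quot.lift OTree.size fun _ _ h => OTree.size_eq_of_step h

/-- The colour of the root. -/
def root : NTree m → Fin (m + 1) :=
  Quot.lift (fun t => match t with | .node l _ => l) (by rintro _ _ (_ | _) <;> rfl)

/-- The multiset of the trees `τ₁, …, τ_κ` in `τ = [τ₁, …, τ_κ]_l`. -/
def children : NTree m → Multiset (NTree m) :=
  Quot.lift (fun t => match t with | .node _ ts => (↑(ts.map mk) : Multiset (NTree m)))
    (by
      rintro _ _ (⟨l, h⟩ | ⟨l, as, bs, h⟩)
      · exact Multiset.coe_eq_coe.2 (h.map _)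
      · simp only [List.map_append, List.map_cons, sound h])

/-- The tree `[τ₁, …, τ_κ]_l`; the one-vertex tree `•_l` is `node l 0`. -/
noncomputable def node (l : Fin (m + 1)) (M : Multiset (NTree m)) : NTree m :=
  mk (OTree.node l (M.toList.map out))

@[simp] theorem root_node (l : Fin (m + 1)) (M : Multiset (NTree m)) : (node l M).root = l := rfl

@[simp] theorem children_node (l : Fin (m + 1)) (M : Multiset (NTree m)) :
    (node l M).children = M := by
  have h : (node l M).children = ↑((M.toList.map out).map mk) := rfl
  have h2 : (mk ∘ out : NTree m → NTree m) = id := by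
    funext t; exact mk_out t
  rw [h, List.map_map, h2, List.map_id]
  exact Multiset.coe_toList M

theorem mk_congr (l : Fin (m + 1)) (as bs : List (OTree m)) {t u : OTree m} (h : mk t = mk u) :
    mk (.node l (as ++ t :: bs)) = mk (.node l (as ++ u :: bs)) :=
  congrArg (Quot.lift (fun t => mk (.node l (as ++ t :: bs)))
    fun _ _ h => sound (.congr l as bs h)) h

/-- Every nonempty tree is `[τ₁, …, τ_κ]_l` for its root colour and its branches. -/
@[simp] theorem node_root_children (τ : NTree m) : node τ.root τ.children = τ := by
  obtain ⟨t, rfl⟩ := exists_mk τ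
  obtain ⟨l, ts⟩ := t
  have key : ∀ (bs as : List (OTree m)),
      mk (.node l (as ++ (bs.map mk).map out)) = mk (.node l (as ++ bs)) := by
    intro bs
    induction bs with
    | nil => intro as; rfl
    | cons b bs ih =>
      intro as
      simp only [List.map_cons]
      rw [mk_congr l as _ (mk_out (mk b))]
      simpa using ih (as ++ [b])
  have h1 : ((↑(ts.map mk) : Multiset (NTree m)).toList).Perm (ts.map mk) :=
    Multiset.coe_eq_coe.1 (Multiset.coe_toList _)
  exact (sound (.perm l (h1.map out))).trans (key ts [])

theorem size_eq (τ : NTree m) : τ.size = 1 + (τ.children.map size).sum := by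
  obtain ⟨t, rfl⟩ := exists_mk τ
  obtain ⟨l, ts⟩ := t
  change OTree.size _ = 1 + (Multiset.map size (↑(ts.map mk) : Multiset (NTree m))).sum
  rw [OTree.size, Multiset.map_coe, Multiset.sum_coe, List.map_map]
  rfl

theorem size_pos (τ : NTree m) : 0 < τ.size := by rw [size_eq]; omega

theorem size_lt_of_mem {t τ : NTree m} (h : t ∈ τ.children) : t.size < τ.size := by
  rw [size_eq τ]
  have := Multiset.single_le_sum (fun _ _ => Nat.zero_le _) _ (Multiset.mem_map_of_mem size h)
  omega

theorem finite_size_le (n : ℕ) : {τ : NTree m | τ.size ≤ n}.Finite := by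
  induction n with
  | zero =>
    refine Set.Finite.subset Set.finite_empty fun τ h => ?_
    have := τ.size_pos
    rw [Set.mem_ofPred_eq] at h
    omega
  | succ n ih =>
    have hfin : {M : Multiset (NTree m) | (∀ t ∈ M, t ∈ ih.toFinset) ∧ M.card ≤ n}.Finite := by
      refine Set.Finite.subset (n • ih.toFinset.val).powerset.toFinset.finite_toSet ?_
      rintro M ⟨h1, h2⟩
      simp only [Finset.mem_coe, Multiset.mem_toFinset, Multiset.mem_powerset]
      rw [Multiset.le_iff_count]
      intro t
      by_cases ht : t ∈ M
      · have := Multiset.count_eq_one_of_mem ih.toFinset.nodup (h1 t ht)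
        rw [Multiset.count_nsmul, this, mul_one]
        exact (Multiset.count_le_card t M).trans h2
      · rw [Multiset.count_eq_zero_of_notMem ht]; exact Nat.zero_le _
    refine Set.Finite.subset ((Set.finite_univ.prod hfin).image fun p => node p.1 p.2) ?_
    intro τ h
    rw [Set.mem_ofPred_eq] at h
    refine ⟨(τ.root, τ.children), ⟨trivial, ?_, ?_⟩, node_root_children τ⟩
    · intro t ht
      have := size_lt_of_mem ht
      simp only [Set.Finite.mem_toFinset, Set.mem_ofPred_eq]
      omega
    · rw [size_eq] at h
      have h2 : (τ.children.map fun _ => 1).sum ≤ (τ.children.map size).sum :=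
        Multiset.sum_map_le_sum_map _ _ fun t _ => t.size_pos
      simp only [Multiset.map_const', Multiset.sum_replicate, smul_eq_mul, mul_one] at h2
      show τ.children.card ≤ n
      omega

end NTree

section Trees

variable {m : ℕ}

/-- The number of vertices; the empty tree has none. -/
def size : T m → ℕ
  | none => 0
  | some τ => τ.size

theorem finite_size_eq (n : ℕ) : {τ : T m | size τ = n}.Finite := by
  refine Set.Finite.subset (((NTree.finite_size_le n).image some).union (Set.finite_singleton none))
    fun τ h => ?_
  cases τ with
  | none => exact Or.inr rfl
  | some τ => exact Or.inl ⟨τ, le_of_eq h, rfl⟩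

/-- The finite set of all trees with exactly `n` vertices. -/
noncomputable def treesOfSize (m n : ℕ) : Finset (T m) := (finite_size_eq n).toFinset

/-- `r₁! r₂! ⋯ r_q!`, where `r₁, …, r_q` count equal elements of `M`. -/
def symFactor {β : Type*} [DecidableEq β] (M : Multiset β) : ℕ :=
  ∏ x ∈ M.toFinset, (M.count x).factorial

/-- The coefficient `α(τ)` for nonempty `τ`. -/
noncomputable def NTree.alpha (τ : NTree m) : ℚ :=
  1 / (symFactor τ.children : ℚ) * (τ.children.attach.map fun t => NTree.alpha t.1).prod
termination_by τ.size
decreasing_by exact NTree.size_lt_of_mem t.2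

/-- The coefficient `α(τ)`, with `α(∅) = 1`. -/
noncomputable def alpha : T m → ℚ
  | none => 1
  | some τ => τ.alpha

/-- `𝔥([τ₁, …, τ_κ]_l) = 1 + max_j 𝔥(τ_j)`, and `𝔥(•_l) = 1`. -/
noncomputable def NTree.height (τ : NTree m) : ℕ :=
  1 + (τ.children.attach.map fun t => NTree.height t.1).sup
termination_by τ.size
decreasing_by exact NTree.size_lt_of_mem t.2

/-- The height `𝔥(τ)`, with `𝔥(∅) = 0`. -/
noncomputable def height : T m → ℕ
  | none => 0
  | some τ => τ.height

end Trees

/-! ### Elementary differentials -/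

section Elementary

variable {d m : ℕ}

/-- The elementary differential
`F([τ₁, …, τ_κ]_l)(x) = g_l^{(κ)}(x)(F(τ₁)(x), …, F(τ_κ)(x))`; in particular `F(•_l) = g_l`.
The branches are listed in some order, which is irrelevant for smooth `g_l` because
higher derivatives are symmetric. -/
noncomputable def NTree.F (g : Fin (m + 1) → EuclideanSpace ℝ (Fin d) → EuclideanSpace ℝ (Fin d))
    (τ : NTree m) (x : EuclideanSpace ℝ (Fin d)) : EuclideanSpace ℝ (Fin d) :=
  iteratedFDeriv ℝ τ.children.toList.length (g τ.root) x
    fun i => NTree.F g (τ.children.toList.get i) x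
termination_by τ.size
decreasing_by exact NTree.size_lt_of_mem (Multiset.mem_toList.1 (List.get_mem _ i))

/-- The elementary differential `F(τ)`, with `F(∅)(x) = x`. -/
noncomputable def F (g : Fin (m + 1) → EuclideanSpace ℝ (Fin d) → EuclideanSpace ℝ (Fin d)) :
    T m → EuclideanSpace ℝ (Fin d) → EuclideanSpace ℝ (Fin d)
  | none => fun x => x
  | some τ => NTree.F g τ

end Elementary

/-! ### Subtrees, remainders and the composition of weight functions -/

section Composition

variable {m : ℕ}

/-- A subtree sharing the root, together with the multiset of the trees left over. -/
abbrev Cut (m : ℕ) : Type := T m × Multiset (NTree m)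

/-- The cut `([ϑ₁, …, ϑ_κ]_l, ω₁ ∪ ⋯ ∪ ω_κ)` assembled from triples `(τ_j, ϑ_j, ω_j)`; empty
`ϑ_j` are discarded. -/
noncomputable def assemble (l : Fin (m + 1)) (D : Multiset (NTree m × Cut m)) : Cut m :=
  (some (NTree.node l (D.filterMap fun x => x.2.1)), (D.map fun x => x.2.2).sum)

/-- Given sets `S t` of cuts of the trees `t`, all multisets `{(τ₁, ϑ₁, ω₁), …, (τ_κ, ϑ_κ, ω_κ)}` with
`{τ₁, …, τ_κ} = M` and `(ϑ_j, ω_j) ∈ S τ_j`. -/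
noncomputable def decsOf (M : Multiset (NTree m)) (S : ∀ t ∈ M, Finset (Cut m)) :
    Finset (Multiset (NTree m × Cut m)) :=
  (Multiset.Sections (M.attach.map fun t => (S t.1 t.2).val.map fun p => (t.1, p))).toFinset

theorem fst_mem_of_mem_decsOf {M : Multiset (NTree m)} {S : ∀ t ∈ M, Finset (Cut m)}
    {D : Multiset (NTree m × Cut m)} (hD : D ∈ decsOf M S) {x : NTree m × Cut m} (hx : x ∈ D) :
    x.1 ∈ M := by
  rw [decsOf, Multiset.mem_toFinset, Multiset.mem_sections] at hD
  obtain ⟨s, hs, hxs⟩ := Multiset.exists_mem_of_rel_of_mem (Multiset.rel_flip.2 hD) hx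
  obtain ⟨t, -, rfl⟩ := Multiset.mem_map.1 hs
  obtain ⟨p, -, rfl⟩ := Multiset.mem_map.1 hxs
  exact t.2

/-- `ST(τ)` for nonempty `τ`. -/
noncomputable def NTree.STset (τ : NTree m) : Finset (Cut m) :=
  insert (none, {τ})
    ((decsOf τ.children fun t _ => NTree.STset t).image (assemble τ.root))
termination_by τ.size
decreasing_by exact NTree.size_lt_of_mem (by assumption)

/-- The set `ST(τ)` of all pairs (subtree, remainder multiset); `ST(∅) = {(∅, ∅)}`. -/
noncomputable def STset : T m → Finset (Cut m)
  | none => {(none, 0)}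
  | some τ => τ.STset

/-- The multisets of triples `(τ_j, ϑ_j, ω_j)`, one for each branch `τ_j` of `τ`, with
`(ϑ_j, ω_j) ∈ ST(τ_j)`. -/
noncomputable def NTree.decs (τ : NTree m) : Finset (Multiset (NTree m × Cut m)) :=
  decsOf τ.children fun t _ => t.STset

/-- `γ(τ, ϑ, ω)` for nonempty `τ`. It is `1` for `ϑ = ∅`. Otherwise each way `D` of writing
`(ϑ, ω)` by triples `(τ_j, ϑ_j, ω_j)` contributes
`R₁! ⋯ R_Q! / (s₁! ⋯ s_{p₀}! r₁₁! ⋯ r_{q p_q}!) · ∏ γ(τ_j, ϑ_j, ω_j)`, where the `R_i` are the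
multiplicities of the branches of `τ` and the `s_k`, `r_{ik}` those of the triples in `D`
with `ϑ_j = ∅` and with `ϑ_j ≠ ∅`, respectively. -/
noncomputable def NTree.gamma (τ : NTree m) (p : Cut m) : ℚ :=
  if p.1 = none then 1 else
    ∑ D ∈ τ.decs.attach, if assemble τ.root D.1 = p then
      (symFactor τ.children : ℚ) / (symFactor D.1 : ℚ) *
        (D.1.attach.map fun x => NTree.gamma x.1.1 x.1.2).prod
      else 0
termination_by τ.size
decreasing_by exact NTree.size_lt_of_mem (fst_mem_of_mem_decsOf D.2 x.2)

/-- `γ(τ, ϑ, ω)`, with `γ(∅, ∅, ∅) = 1`. -/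
noncomputable def gamma : T m → Cut m → ℚ
  | none, _ => 1
  | some τ, p => τ.gamma p

/-- Weight functions: to each tree and each `h ≥ 0` a real function on `Ω`. -/
abbrev Weight (m : ℕ) (Ω : Type*) : Type _ := T m → ℝ≥0 → Ω → ℝ

/-- Weight functions with values in random variables, i.e. `φ : T → Ξ`. -/
def IsWeight {Ω : Type*} [MeasurableSpace Ω] (φ : Weight m Ω) : Prop :=
  ∀ τ h, Measurable (φ τ h)

/-- The composition
`(φ_x ∘ φ_y)(τ) = ∑_{(ϑ, ω) ∈ ST(τ)} γ(τ, ϑ, ω) φ_y(ϑ) ∏_{δ ∈ ω} φ_x(δ)`. -/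
noncomputable def wcomp {Ω : Type*} (φx φy : Weight m Ω) : Weight m Ω := fun τ h ω =>
  ∑ p ∈ STset τ, (gamma τ p : ℝ) * (φy p.1 h ω * (p.2.map fun δ => φx (some δ) h ω).prod)

/-- The weights `Φ_k` of simple iteration started from the predictor weights `Φ₀`:
`Φ_{k+1}(∅) = 1` and `Φ_{k+1}(τ) = Φ_ex(τ) + (Φ_k ∘ Φ_im)(τ)` otherwise. -/
noncomputable def iterWeight {Ω : Type*} (Φex Φim Φ0 : Weight m Ω) : ℕ → Weight m Ω
  | 0 => Φ0
  | k + 1 => fun τ => match τ with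
    | none => 1
    | some τ => Φex (some τ) + wcomp (iterWeight Φex Φim Φ0 k) Φim (some τ)

/-- `Φ` is the weight function of the exact solution of the implicit scheme: `Φ(∅) = 1` and
`Φ(τ) = Φ_ex(τ) + (Φ ∘ Φ_im)(τ)`. -/
def IsNumericalWeight {Ω : Type*} [MeasurableSpace Ω] (Φex Φim Φ : Weight m Ω) : Prop :=
  IsWeight Φ ∧ Φ none = 1 ∧ ∀ τ, Φ τ = Φex τ + wcomp Φ Φim τ

/-- `𝔤` is a growth function for the iterated weights `Φk` and the limit weights `Φ`. -/
def IsGrowthFunction {Ω : Type*} (𝔤 : T m → ℕ) (Φk : ℕ → Weight m Ω) (Φ : Weight m Ω) : Prop :=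
  ∀ k, (∀ τ, 𝔤 τ ≤ k → Φk k τ = Φ τ) → ∀ τ, 𝔤 τ ≤ k + 1 → Φk (k + 1) τ = Φ τ

end Composition

/-! ### B-series

As formal series they are graded by the number of vertices: a formal series in `ℝᵈ` is the
sequence of its homogeneous components, that is, a formal power series in a bookkeeping variable
which multiplies all the `g_l`. -/

section Series

variable {d m : ℕ}

/-- Formal series with coefficients in `ℝᵈ`. -/
abbrev FormalSeries (d : ℕ) : Type := ℕ → EuclideanSpace ℝ (Fin d)

/-- The formal B-series `B(φ, x) = ∑_τ α(τ) φ(τ) F(τ)(x)`. -/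
noncomputable def bSeries
    (g : Fin (m + 1) → EuclideanSpace ℝ (Fin d) → EuclideanSpace ℝ (Fin d))
    (φ : T m → ℝ) (x : EuclideanSpace ℝ (Fin d)) : FormalSeries d := fun n =>
  ∑ τ ∈ treesOfSize m n, ((alpha τ : ℝ) * φ τ) • F g τ x

/-- Substitution of the formal series `Y = Y₀ + Y₁ + ⋯` into a smooth `f` through its Taylor series
at `Y₀`, `∑_κ f^{(κ)}(Y₀)(Y - Y₀, …, Y - Y₀) / κ!`; the component of degree `n` collects the
terms `f^{(κ)}(Y₀)(Y_{n₁}, …, Y_{n_κ}) / κ!` with `n₁ + ⋯ + n_κ = n` and all `n_i ≥ 1`. -/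
noncomputable def formalSubst (f : EuclideanSpace ℝ (Fin d) → EuclideanSpace ℝ (Fin d))
    (Y : FormalSeries d) : FormalSeries d := fun n =>
  ∑ c : Composition n, ((c.length.factorial : ℝ)⁻¹) •
    iteratedFDeriv ℝ c.length f (Y 0) fun i => Y (c.blocksFun i)

/-- The formal B-series `B(φ, Y) = ∑_ϑ α(ϑ) φ(ϑ) F(ϑ)(Y)` whose argument is a formal series: the
tree `ϑ` has degree `|ϑ|`, so it contributes the component of degree `n - |ϑ|` of `F(ϑ)(Y)`. -/
noncomputable def bSeriesAt
    (g : Fin (m + 1) → EuclideanSpace ℝ (Fin d) → EuclideanSpace ℝ (Fin d))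
    (φ : T m → ℝ) (Y : FormalSeries d) : FormalSeries d := fun n =>
  ∑ q ∈ Finset.HasAntidiagonal.antidiagonal n, ∑ ϑ ∈ treesOfSize m q.1,
    ((alpha ϑ : ℝ) * φ ϑ) • formalSubst (F g ϑ) Y q.2

/-- The sum of a convergent B-series. -/
noncomputable def bSum
    (g : Fin (m + 1) → EuclideanSpace ℝ (Fin d) → EuclideanSpace ℝ (Fin d))
    (φ : T m → ℝ) (x : EuclideanSpace ℝ (Fin d)) : EuclideanSpace ℝ (Fin d) :=
  ∑' τ : T m, ((alpha τ : ℝ) * φ τ) • F g τ x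

/-- The B-series `B(φ, x)` converges. -/
def BConverges
    (g : Fin (m + 1) → EuclideanSpace ℝ (Fin d) → EuclideanSpace ℝ (Fin d))
    (φ : T m → ℝ) (x : EuclideanSpace ℝ (Fin d)) : Prop :=
  Summable fun τ : T m => ((alpha τ : ℝ) * φ τ) • F g τ x

/-- The composed series `B(φ_y, B(φ_x, x))` converges as a multiple series, that is, the family of
all terms `α(ϑ) φ_y(ϑ) F(ϑ)^{(κ)}(x)(v(δ₁), …, v(δ_κ)) / κ!` with `v(δ) = α(δ) φ_x(δ) F(δ)(x)`. -/
def BCompConverges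
    (g : Fin (m + 1) → EuclideanSpace ℝ (Fin d) → EuclideanSpace ℝ (Fin d))
    (φx φy : T m → ℝ) (x : EuclideanSpace ℝ (Fin d)) : Prop :=
  Summable fun p : T m × List (NTree m) =>
    ((alpha p.1 : ℝ) * φy p.1) • ((p.2.length.factorial : ℝ)⁻¹) •
      iteratedFDeriv ℝ p.2.length (F g p.1) x fun i =>
        ((alpha (some (p.2.get i)) : ℝ) * φx (some (p.2.get i))) • F g (some (p.2.get i)) x

end Series

end StochB

namespace StochB

/-! ### Cuts of trees -/

section Cuts

variable {m : ℕ}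

/-! The series statements rest on the composition rule `bSeriesAt_bSeries`: if φ_x(∅) = 1 and φ_y(∅)
= 0, then B(φ_y, B(φ_x, x₀)) = B(φ_x ∘ φ_y, x₀). Since B is additive in the weights, the recursion
for Y_{1,k} then becomes the recursion for Φ_k.

For the rule, a real variable t carries the degree and w(t) is the truncated B-series without its
constant term. By induction on ϑ (`isBigO_cutSeries_sub`), α(ϑ) t^|ϑ| F(ϑ)(x₀ + w(t)) agrees up to
O(t^(N+1)) with the sum of α(τ) γ(τ,ϑ,ω) ∏φ_x(δ) t^|τ| F(τ)(x₀) over all cuts with subtree ϑ. The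
step writes F(ϑ) as a mixed derivative of g_l along the F of the branches, Taylor expands in w and
inserts the induction hypothesis. The directions are then sums over cuts: cuts with empty subtree
make up w, cuts with subtree q make up the branch q. Collecting equal multisets of triples
(`dmul_sum_expand`) produces exactly the multiplicities in γ. Coefficients of such asymptotic
expansions are unique (`sum_eq_zero_of_isBigO`), which turns the estimates into identities degree by
degree.

In the convergent case the composed multiple series is summed in two ways: tree by tree it gives the
value of B(φ_y, ·) at the sum of B(φ_x, x₀), because analytic functions equal their Taylor sums
(`tsum_taylor_eq`); by total degree it gives the formal composition.

The statements about height use only that Φ_im(∅) = 0 kills the one cut that leaves τ itself over.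
All other remainders have smaller height, so (Φ ∘ Φ_im)(τ) depends on Φ below the height of τ only
(`wcomp_some_congr`). For sharpness, weights are chosen for which the composition at τ is the
product over the branches. -/

theorem NTree.induction {p : NTree m → Prop}
    (h : ∀ τ : NTree m, (∀ t ∈ τ.children, p t) → p τ) (τ : NTree m) : p τ := by
  induction hn : τ.size using Nat.strong_induction_on generalizing τ with
  | _ n ih =>
    subst hn
    exact h τ fun t ht => ih _ (NTree.size_lt_of_mem ht) t rfl

/-- Removes `attach` and `Sections`: a section picks one cut per branch, so it is a multiset of
triples lying over `M`. Everything later about decompositions uses this form. -/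
theorem mem_decsOf {M : Multiset (NTree m)} {S : NTree m → Finset (Cut m)}
    {D : Multiset (NTree m × Cut m)} :
    D ∈ decsOf M (fun t _ => S t) ↔ D.map Prod.fst = M ∧ ∀ x ∈ D, x.2 ∈ S x.1 := by
  have h : (M.attach.map fun t => (S t.1).val.map fun p => (t.1, p)) =
      M.map fun t => (S t).val.map fun p => (t, p) := by
    exact Multiset.attach_map_val' M fun t => (S t).val.map fun p => (t, p)
  rw [decsOf, Multiset.mem_toFinset, Multiset.mem_sections, h, Multiset.rel_map_left]
  clear h
  induction M using Multiset.induction generalizing D with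
  | empty =>
    rw [Multiset.rel_zero_left, Multiset.map_eq_zero]
    exact ⟨fun h => by simp [h], fun h => h.1⟩
  | cons t M ih =>
    rw [Multiset.rel_cons_left]
    constructor
    · rintro ⟨x, D, hx, hD, rfl⟩
      obtain ⟨p, hp, rfl⟩ := Multiset.mem_map.1 hx
      obtain ⟨h1, h2⟩ := ih.1 hD
      refine ⟨by simp [h1], fun x hx => ?_⟩
      rcases Multiset.mem_cons.1 hx with rfl | hx
      · exact hp
      · exact h2 x hx
    · rintro ⟨h1, h2⟩
      obtain ⟨x, hx, hxt, hM⟩ := (Multiset.map_eq_cons Prod.fst D M t).2 h1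
      refine ⟨x, D.erase x, ?_, ih.2
        ⟨hM, fun y hy => h2 y (Multiset.mem_of_mem_erase hy)⟩, (Multiset.cons_erase hx).symm⟩
      subst hxt
      exact Multiset.mem_map.2 ⟨x.2, h2 x hx, rfl⟩

theorem NTree.mem_decs {τ : NTree m} {D : Multiset (NTree m × Cut m)} :
    D ∈ τ.decs ↔ D.map Prod.fst = τ.children ∧ ∀ x ∈ D, x.2 ∈ x.1.STset :=
  mem_decsOf

theorem NTree.STset_eq (τ : NTree m) :
    τ.STset = insert (none, {τ}) (τ.decs.image (assemble τ.root)) := by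
  rw [NTree.STset]; rfl

theorem NTree.alpha_eq (τ : NTree m) :
    τ.alpha = 1 / (symFactor τ.children : ℚ) * (τ.children.map NTree.alpha).prod := by
  rw [NTree.alpha, Multiset.attach_map_val' τ.children NTree.alpha]

theorem NTree.height_eq (τ : NTree m) :
    τ.height = 1 + (τ.children.map NTree.height).sup := by
  rw [NTree.height, Multiset.attach_map_val' τ.children NTree.height]

theorem NTree.height_lt_of_mem {t τ : NTree m} (h : t ∈ τ.children) : t.height < τ.height := by
  rw [NTree.height_eq τ]
  have := Multiset.le_sup (Multiset.mem_map_of_mem NTree.height h)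
  omega

theorem symFactor_ne_zero {β : Type*} [DecidableEq β] (M : Multiset β) :
    (symFactor M : ℚ) ≠ 0 := by
  rw [symFactor, Nat.cast_ne_zero]
  exact Finset.prod_ne_zero_iff.2 fun x _ => Nat.factorial_ne_zero _

theorem NTree.gamma_none (τ : NTree m) (ω : Multiset (NTree m)) : τ.gamma (none, ω) = 1 := by
  rw [NTree.gamma, if_pos rfl]

theorem NTree.gamma_some (τ : NTree m) (p : Cut m) (hp : p.1 ≠ none) :
    τ.gamma p = ∑ D ∈ τ.decs with assemble τ.root D = p,
      (symFactor τ.children : ℚ) / (symFactor D : ℚ) *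
        (D.map fun x => NTree.gamma x.1 x.2).prod := by
  rw [NTree.gamma, if_neg hp, Finset.sum_filter, ← Finset.sum_attach τ.decs]
  refine Finset.sum_congr rfl fun D _ => ?_
  rw [Multiset.attach_map_val' D.1 fun x : NTree m × Cut m => NTree.gamma x.1 x.2]

/-- Sums over the cuts of a tree in terms of decompositions into cuts of the branches. -/
theorem NTree.sum_STset {E : Type*} [AddCommGroup E] [Module ℝ E] (τ : NTree m)
    (f : Cut m → E) :
    ∑ p ∈ τ.STset, (τ.gamma p : ℝ) • f p = f (none, {τ}) +
      ∑ D ∈ τ.decs, ((symFactor τ.children : ℝ) / (symFactor D : ℝ) *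
        (D.map fun x => (NTree.gamma x.1 x.2 : ℝ)).prod) • f (assemble τ.root D) := by
  rw [NTree.STset_eq, Finset.sum_insert, NTree.gamma_none, Rat.cast_one, one_smul]
  · congr 1
    -- Several decompositions may assemble to the same cut; γ is the sum over that fibre, so summing
    -- over cuts amounts to summing over decompositions.
    rw [← Finset.sum_fiberwise_of_maps_to
      (s := τ.decs) (g := assemble τ.root) fun D hD => Finset.mem_image_of_mem _ hD]
    refine Finset.sum_congr rfl fun p hp => ?_
    obtain ⟨D₀, -, rfl⟩ := Finset.mem_image.1 hp
    rw [NTree.gamma_some _ _ (by simp [assemble]), Rat.cast_sum, Finset.sum_smul]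
    refine Finset.sum_congr rfl fun D hD => ?_
    rw [(Finset.mem_filter.1 hD).2]
    congr 1
    rw [Rat.cast_mul, Rat.cast_div, Rat.cast_natCast, Rat.cast_natCast]
    congr 1
    have := map_multiset_prod (Rat.castHom ℝ) (D.map fun x => NTree.gamma x.1 x.2)
    rwa [Multiset.map_map] at this
  · intro h
    obtain ⟨D, -, hD⟩ := Finset.mem_image.1 h
    simp [assemble] at hD

theorem NTree.size_le_of_mem_STset (τ : NTree m) : ∀ p ∈ τ.STset, StochB.size p.1 ≤ τ.size := by
  induction τ using NTree.induction with
  | h τ ih =>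
    intro p hp
    rw [NTree.STset_eq, Finset.mem_insert, Finset.mem_image] at hp
    rcases hp with rfl | ⟨D, hD, rfl⟩
    · exact Nat.zero_le _
    obtain ⟨h1, h2⟩ := NTree.mem_decs.1 hD
    have key : ∀ D : Multiset (NTree m × Cut m), (∀ x ∈ D, StochB.size x.2.1 ≤ x.1.size) →
        ((D.filterMap fun x => x.2.1).map fun t => t.size).sum ≤
          ((D.map Prod.fst).map fun t => t.size).sum := by
      intro D
      induction D using Multiset.induction with
      | empty => intro _; simp
      | cons x D ihD =>
        intro h
        have hx := h x (Multiset.mem_cons_self _ _)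
        have hD := ihD fun y hy => h y (Multiset.mem_cons_of_mem hy)
        rw [Multiset.filterMap_cons]
        rcases hx' : x.2.1 with _ | ϑ
        · simp only [Option.map_none, Option.getD_none, zero_add, Multiset.map_cons,
            Multiset.sum_cons]
          omega
        · rw [hx'] at hx
          simp only [StochB.size] at hx
          simp only [Option.map_some, Option.getD_some, Multiset.map_cons, Multiset.sum_cons,
            Multiset.singleton_add]
          omega
    have h3 := key D fun x hx => ih x.1 (by rw [← h1]; exact Multiset.mem_map_of_mem _ hx) _
      (h2 x hx)
    rw [h1] at h3
    change (NTree.node τ.root (D.filterMap fun x => x.2.1)).size ≤ τ.size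
    rw [NTree.size_eq, NTree.size_eq τ, NTree.children_node]
    exact Nat.add_le_add_left h3 1

end Cuts

/-! ### Compositions of weight functions and simple iteration -/

section Weights

variable {m : ℕ} {Ω : Type*}

theorem wcomp_none (φx φy : Weight m Ω) : wcomp φx φy none = φy none := by
  funext h ω
  simp [wcomp, STset, gamma]

theorem wcomp_some (φx φy : Weight m Ω) (τ : NTree m) (h : ℝ≥0) (ω : Ω) :
    wcomp φx φy (some τ) h ω = φy none h ω * φx (some τ) h ω +
      ∑ D ∈ τ.decs, ((symFactor τ.children : ℝ) / (symFactor D : ℝ) *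
        (D.map fun x => (NTree.gamma x.1 x.2 : ℝ)).prod) *
        (φy (assemble τ.root D).1 h ω *
          ((assemble τ.root D).2.map fun δ => φx (some δ) h ω).prod) := by
  have := NTree.sum_STset τ fun p => φy p.1 h ω * (p.2.map fun δ => φx (some δ) h ω).prod
  simp only [smul_eq_mul, Multiset.map_singleton, Multiset.prod_singleton] at this
  exact this

/-- Once the root is kept, every leftover tree comes from a cut of some branch: it is the whole
branch or, by induction, lower than it. -/
theorem NTree.height_lt_of_mem_assemble (τ : NTree m) :
    ∀ D ∈ τ.decs, ∀ δ ∈ (assemble τ.root D).2, δ.height < τ.height := by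
  induction τ using NTree.induction with
  | h τ ih =>
    intro D hD δ hδ
    obtain ⟨h1, h2⟩ := NTree.mem_decs.1 hD
    obtain ⟨s, hs, hδ⟩ := Multiset.mem_join.1 hδ
    obtain ⟨x, hx, rfl⟩ := Multiset.mem_map.1 hs
    have hm : x.1 ∈ τ.children := by rw [← h1]; exact Multiset.mem_map_of_mem _ hx
    refine lt_of_le_of_lt ?_ (NTree.height_lt_of_mem hm)
    have hp := h2 x hx
    rw [NTree.STset_eq, Finset.mem_insert, Finset.mem_image] at hp
    rcases hp with hp | ⟨D', hD', hp⟩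
    · rw [hp] at hδ
      rw [Multiset.mem_singleton.1 hδ]
    · rw [← hp] at hδ
      exact (ih x.1 hm D' hD' δ hδ).le

/-- The cut (∅, {τ}) carries the factor φ_y(∅) = 0, and all other remainders are lower than τ. This
makes the fixed point equation triangular in the height. -/
theorem wcomp_some_congr {φ φ' φy : Weight m Ω} (hy : φy none = 0) (τ : NTree m)
    (h : ∀ δ : NTree m, δ.height < τ.height → φ (some δ) = φ' (some δ)) :
    wcomp φ φy (some τ) = wcomp φ' φy (some τ) := by
  funext s ω
  rw [wcomp_some, wcomp_some, hy]
  simp only [Pi.zero_apply, zero_mul, zero_add]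
  refine Finset.sum_congr rfl fun D hD => ?_
  congr 3
  exact Multiset.map_congr rfl fun δ hδ => by
    rw [h δ (NTree.height_lt_of_mem_assemble τ D hD δ hδ)]

theorem measurable_multiset_prod {Ω β : Type*} [MeasurableSpace Ω] (f : β → Ω → ℝ)
    (hf : ∀ b, Measurable (f b)) (M : Multiset β) :
    Measurable fun ω => (M.map fun b => f b ω).prod := by
  induction M using Multiset.induction with
  | empty => simp
  | cons b M ih =>
    simp only [Multiset.map_cons, Multiset.prod_cons]
    exact (hf b).mul ih

theorem IsWeight.wcomp [MeasurableSpace Ω] {φx φy : Weight m Ω} (hx : IsWeight φx)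
    (hy : IsWeight φy) : IsWeight (wcomp φx φy) := fun _ h =>
  Finset.measurable_sum _ fun p _ => ((hy p.1 h).mul
    (measurable_multiset_prod (fun δ ω => φx (some δ) h ω) (fun δ => hx (some δ) h) p.2)).const_mul _

section Iteration

variable {Φex Φim Φ0 : Weight m Ω}

theorem iterWeight_succ (hex : Φex none = 1) (him : Φim none = 0) (k : ℕ) (τ : T m) :
    iterWeight Φex Φim Φ0 (k + 1) τ = Φex τ + wcomp (iterWeight Φex Φim Φ0 k) Φim τ := by
  cases τ with
  | none => rw [wcomp_none, hex, him, add_zero]; rfl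
  | some τ => rfl

theorem iterWeight_none (h0 : Φ0 none = 1) (k : ℕ) : iterWeight Φex Φim Φ0 k none = 1 := by
  cases k with
  | zero => exact h0
  | succ k => rfl

theorem isWeight_iterWeight [MeasurableSpace Ω] (hex : IsWeight Φex) (him : IsWeight Φim)
    (h0 : IsWeight Φ0) (k : ℕ) : IsWeight (iterWeight Φex Φim Φ0 k) := by
  induction k with
  | zero => exact h0
  | succ k ih =>
    intro τ h
    cases τ with
    | none => exact measurable_const
    | some τ => exact (hex _ h).add (ih.wcomp him _ h)

/-- The iteration is stationary at τ from step 𝔥(τ) on, which is what lets a limit weight be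
defined. -/
theorem iterWeight_eq_of_height_le (h0 : Φ0 none = 1) (him : Φim none = 0) (k : ℕ) :
    ∀ j, k ≤ j → ∀ τ : T m, height τ ≤ k →
      iterWeight Φex Φim Φ0 j τ = iterWeight Φex Φim Φ0 k τ := by
  induction k with
  | zero =>
    intro j _ τ hτ
    cases τ with
    | none => rw [iterWeight_none h0, iterWeight_none h0]
    | some τ =>
      have : τ.height ≤ 0 := hτ
      rw [NTree.height_eq] at this
      omega
  | succ k ih =>
    intro j hj τ hτ
    cases τ with
    | none => rw [iterWeight_none h0, iterWeight_none h0]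
    | some τ =>
      obtain ⟨j, rfl⟩ := Nat.exists_eq_add_of_le' hj
      change Φex (some τ) + wcomp (iterWeight Φex Φim Φ0 (j + k)) Φim (some τ) =
        Φex (some τ) + wcomp (iterWeight Φex Φim Φ0 k) Φim (some τ)
      rw [wcomp_some_congr him τ fun δ hδ => ih (j + k) (by omega) (some δ) ?_]
      have : τ.height ≤ k + 1 := hτ
      change δ.height ≤ k
      omega

theorem IsNumericalWeight.unique [MeasurableSpace Ω] {Φ Φ' : Weight m Ω} (him : Φim none = 0)
    (h : IsNumericalWeight Φex Φim Φ) (h' : IsNumericalWeight Φex Φim Φ') : Φ = Φ' := by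
  have key : ∀ n, ∀ τ : NTree m, τ.height < n → Φ (some τ) = Φ' (some τ) := by
    intro n
    induction n with
    | zero => intro τ hτ; omega
    | succ n ih =>
      intro τ hτ
      rw [h.2.2, h'.2.2, wcomp_some_congr him τ fun δ hδ => ih δ (by omega)]
  funext τ
  cases τ with
  | none => rw [h.2.1, h'.2.1]
  | some τ => exact key _ τ (Nat.lt_succ_self _)

/-- Existence: Φ(τ) is the stationary value, read off at step 𝔥(τ). Φ_ex serves as predictor because
it is already a weight function with value 1 at ∅. -/
theorem existsUnique_isNumericalWeight [MeasurableSpace Ω] (hex : IsWeight Φex)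
    (him : IsWeight Φim) (hex_empty : Φex none = 1) (him_empty : Φim none = 0) :
    ∃! Φ : Weight m Ω, IsNumericalWeight Φex Φim Φ := by
  refine existsUnique_of_exists_of_unique
    ⟨fun τ => iterWeight Φex Φim Φex (height τ) τ, fun τ h =>
      isWeight_iterWeight hex him hex _ τ h, hex_empty, fun τ => ?_⟩
    fun Φ Φ' h h' => h.unique him_empty h'
  cases τ with
  | none =>
    rw [wcomp_none, him_empty, add_zero]
    rfl
  | some τ =>
    obtain ⟨k, hk⟩ : ∃ k, height (some τ) = k + 1 := ⟨_, (NTree.height_eq τ).trans (add_comm _ _)⟩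
    simp only [hk]
    rw [iterWeight_succ hex_empty him_empty, wcomp_some_congr him_empty τ fun δ hδ => ?_]
    have : τ.height = k + 1 := hk
    exact iterWeight_eq_of_height_le hex_empty him_empty _ k
      (by change δ.height ≤ k; omega) (some δ) le_rfl

theorem isGrowthFunction_height [MeasurableSpace Ω] {Φ : Weight m Ω} (him : Φim none = 0)
    (hΦ : IsNumericalWeight Φex Φim Φ) :
    IsGrowthFunction height (iterWeight Φex Φim Φ0) Φ := by
  intro k hk τ hτ
  cases τ with
  | none => exact hΦ.2.1.symm
  | some τ =>
    rw [hΦ.2.2]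
    change Φex (some τ) + wcomp (iterWeight Φex Φim Φ0 k) Φim (some τ) = _
    rw [wcomp_some_congr him τ fun δ hδ => hk (some δ) ?_]
    have : τ.height ≤ k + 1 := hτ
    change δ.height ≤ k
    omega

end Iteration

/-! ### Sharpness of the growth function -/

section Sharpness

/-- The weight function which is `1` on the one-vertex trees and `0` elsewhere. -/
noncomputable def vertexWeight (m : ℕ) (Ω : Type*) : Weight m Ω
  | none => 0
  | some τ => if τ.children = 0 then 1 else 0

/-- The weight function which is `1` on the empty tree and `0` elsewhere. -/
def emptyWeight (m : ℕ) (Ω : Type*) : Weight m Ω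
  | none => 1
  | some _ => 0

theorem symFactor_map {β β' : Type*} [DecidableEq β] [DecidableEq β'] {f : β → β'}
    (hf : Function.Injective f) (M : Multiset β) : symFactor (M.map f) = symFactor M := by
  rw [symFactor, Multiset.toFinset_map, Finset.prod_image hf.injOn, symFactor]
  simp only [Multiset.count_map_eq_count' f M hf]

/-- Only the cut keeping just the root has a subtree of nonzero weight. Its sole decomposition
removes every branch whole, so the multiplicities of branches and of triples coincide and γ = 1. -/
theorem wcomp_vertexWeight (φ : Weight m Ω) (τ : NTree m) (h : ℝ≥0) (ω : Ω) :
    wcomp φ (vertexWeight m Ω) (some τ) h ω =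
      (τ.children.map fun δ => φ (some δ) h ω).prod := by
  have hinj : Function.Injective fun t : NTree m => ((t, none, {t}) : NTree m × Cut m) :=
    fun t u htu => (Prod.ext_iff.1 htu).1
  rw [wcomp_some, vertexWeight, Pi.zero_apply, Pi.zero_apply, zero_mul, zero_add,
    Finset.sum_eq_single_of_mem (τ.children.map fun t => (t, none, {t}))]
  · have h1 : (assemble τ.root (τ.children.map fun t => (t, none, {t}))).1 =
        some (NTree.node τ.root 0) := by
      rw [assemble, Multiset.eq_zero_of_forall_notMem (s := Multiset.filterMap _ _)]
      simp
    have h2 : (assemble τ.root (τ.children.map fun t => (t, none, {t}))).2 = τ.children := by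
      simp [assemble]
    rw [h1, h2, symFactor_map hinj, Multiset.map_map]
    have h3 : (symFactor τ.children : ℝ) ≠ 0 := by
      exact_mod_cast symFactor_ne_zero τ.children
    simp [NTree.gamma_none, vertexWeight, div_self h3]
  · refine NTree.mem_decs.2 ⟨by simp, fun x hx => ?_⟩
    obtain ⟨t, -, rfl⟩ := Multiset.mem_map.1 hx
    rw [NTree.STset_eq]
    exact Finset.mem_insert_self _ _
  · intro D hD hne
    rw [assemble, vertexWeight, if_neg, Pi.zero_apply, Pi.zero_apply, zero_mul, mul_zero]
    intro h0
    rw [NTree.children_node] at h0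
    obtain ⟨h1, h2⟩ := NTree.mem_decs.1 hD
    apply hne
    rw [← h1, Multiset.map_map]
    refine (Multiset.map_id D).symm.trans (Multiset.map_congr rfl fun x hx => ?_)
    have hx1 : x.2.1 = none := by
      cases hx' : x.2.1 with
      | none => rfl
      | some ϑ =>
        have := (Multiset.mem_filterMap (fun x : NTree m × Cut m => x.2.1) D).2 ⟨x, hx, hx'⟩
        rw [h0] at this
        simp at this
    have hx2 := h2 x hx
    rw [NTree.STset_eq, Finset.mem_insert, Finset.mem_image] at hx2
    rcases hx2 with hx2 | ⟨D', -, hx2⟩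
    · exact Prod.ext rfl hx2
    · rw [← hx2] at hx1
      simp [assemble] at hx1

/-- With these weights the value at a nonempty tree is the product of the previous values at its
branches. The constant 1 is the fixed point, while the predictor vanishes on nonempty trees; the
zero survives along a longest path for as long as k < 𝔥(τ). -/
theorem exists_sharp [MeasurableSpace Ω] [Nonempty Ω] :
    ∃ Ψex Ψim Ψ0 Ψ : Weight m Ω, IsWeight Ψex ∧ IsWeight Ψim ∧ IsWeight Ψ0 ∧
      Ψex none = 1 ∧ Ψim none = 0 ∧ Ψ0 none = 1 ∧ IsNumericalWeight Ψex Ψim Ψ ∧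
      ∀ τ k, k < height τ → iterWeight Ψex Ψim Ψ0 k τ ≠ Ψ τ := by
  have hw : IsWeight (emptyWeight m Ω) := by
    intro τ h
    cases τ <;> exact measurable_const
  refine ⟨emptyWeight m Ω, vertexWeight m Ω, emptyWeight m Ω, fun _ => 1, hw, ?_, hw, rfl, rfl,
    rfl, ⟨fun _ _ => measurable_const, rfl, fun τ => ?_⟩, fun τ k hk => ?_⟩
  · intro τ h
    cases τ with
    | none => exact measurable_const
    | some τ => rw [vertexWeight]; split_ifs <;> exact measurable_const
  · cases τ with
    | none => rw [wcomp_none]; simp [emptyWeight, vertexWeight]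
    | some τ =>
      funext h ω
      rw [Pi.add_apply, Pi.add_apply, wcomp_vertexWeight]
      simp [emptyWeight]
  · have key : ∀ k (τ : NTree m), k < τ.height → ∀ h ω, iterWeight (emptyWeight m Ω)
        (vertexWeight m Ω) (emptyWeight m Ω) k (some τ) h ω = 0 := by
      intro k
      induction k with
      | zero => intro τ _ h ω; rfl
      | succ k ih =>
        intro τ hτ h ω
        change emptyWeight m Ω (some τ) h ω + wcomp _ (vertexWeight m Ω) (some τ) h ω = 0
        rw [wcomp_vertexWeight]
        simp only [emptyWeight, Pi.zero_apply, zero_add]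
        rw [NTree.height_eq] at hτ
        obtain ⟨t, ht, hkt⟩ : ∃ t ∈ τ.children, k < t.height := by
          by_contra! hcon
          have : (τ.children.map NTree.height).sup ≤ k := by
            refine Multiset.sup_le.2 fun b hb => ?_
            obtain ⟨t, ht, rfl⟩ := Multiset.mem_map.1 hb
            exact hcon t ht
          omega
        exact Multiset.prod_eq_zero (Multiset.mem_map.2 ⟨t, ht, ih t hkt h ω⟩)
    cases τ with
    | none => exact absurd hk (Nat.not_lt_zero _)
    | some τ =>
      intro heq
      have := key k τ hk 0 (Classical.arbitrary Ω)
      rw [heq] at this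
      exact one_ne_zero this

end Sharpness

end Weights
-- Multinomial identities for sums over multisets
section Exponential

/-- The multisets of cardinality `n` with elements in a finite set. -/
noncomputable def multisetsOf {β : Type*} [DecidableEq β] (A : Finset β) (n : ℕ) :
    Finset (Multiset β) :=
  (A.sym n).map ⟨Sym.toMultiset, Sym.coe_injective⟩

theorem mem_multisetsOf {β : Type*} [DecidableEq β] {A : Finset β} {n : ℕ} {D : Multiset β} :
    D ∈ multisetsOf A n ↔ D.card = n ∧ ∀ x ∈ D, x ∈ A := by
  rw [multisetsOf, Finset.mem_map]
  constructor
  · rintro ⟨D, hD, rfl⟩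
    exact ⟨D.2, Finset.mem_sym_iff.1 hD⟩
  · rintro ⟨h1, h2⟩
    exact ⟨⟨D, h1⟩, Finset.mem_sym_iff.2 h2, rfl⟩

theorem symFactor_mul_countPerms {β : Type*} [DecidableEq β] (D : Multiset β) :
    symFactor D * D.countPerms = D.card.factorial := by
  have := Nat.multinomial_spec D.toFinset fun x => D.count x
  rw [Multiset.toFinset_sum_count_eq] at this
  rw [← this, Multiset.countPerms, Finsupp.multinomial_eq]
  simp only [Multiset.toFinsupp_support]
  rfl

variable {R : Type*} [CommRing R] [Algebra ℝ R]

/-- The multinomial theorem, with the multinomial coefficient of `D` written as n! / `symFactor D`.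
-/
theorem sum_pow_div_factorial {β : Type*} [DecidableEq β] (A : Finset β) (w : β → R) (n : ℕ) :
    ((n.factorial : ℝ)⁻¹) • (∑ a ∈ A, w a) ^ n =
      ∑ D ∈ multisetsOf A n, ((symFactor D : ℝ)⁻¹) • (D.map w).prod := by
  rw [Finset.sum_pow, multisetsOf, Finset.sum_map _ _ _, Finset.smul_sum]
  refine Finset.sum_congr rfl fun D _ => ?_
  have h := symFactor_mul_countPerms (D : Multiset β)
  have hc : Multiset.card (D : Multiset β) = n := D.2
  rw [hc] at h
  have h0 : (symFactor (D : Multiset β) : ℝ) ≠ 0 := by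
    exact_mod_cast symFactor_ne_zero (D : Multiset β)
  have h1 : (n.factorial : ℝ) ≠ 0 := by exact_mod_cast n.factorial_ne_zero
  have h2 : (symFactor (D : Multiset β) : ℝ) * (D : Multiset β).countPerms = n.factorial := by
    exact_mod_cast h
  change _ • (((D : Multiset β).countPerms : R) * ((D : Multiset β).map w).prod) = _
  rw [← nsmul_eq_mul, ← Nat.cast_smul_eq_nsmul ℝ, smul_smul]
  congr 1
  simp only [Function.Embedding.coeFn_mk]
  field_simp
  rw [← h2, mul_comm]

-- Tag each `a` with the monomial of `p a`, or with 1 if `p a = none`; the monomial of a product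
-- over `D` then records `D.filterMap p`. The identity is the coefficient of `N` in the n-th power
-- of the tagged sum divided by n!, computed once by `sum_pow_div_factorial` and once by the
-- binomial theorem.
open AddMonoidAlgebra in
theorem sum_filterMap_eq {β β' : Type*} [DecidableEq β] [DecidableEq β'] (A : Finset β)
    (p : β → Option β') (w : β → R) (N : Multiset β') (r : ℕ) :
    ∑ D ∈ multisetsOf A (N.card + r) with D.filterMap p = N,
        ((symFactor D : ℝ)⁻¹) • (D.map w).prod =
      ((r.factorial : ℝ)⁻¹ * (symFactor N : ℝ)⁻¹) • ((∑ a ∈ A with p a = none, w a) ^ r *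
        (N.map fun b => ∑ a ∈ A with p a = some b, w a).prod) := by
  set k := N.card with hk
  set n := k + r with hn
  let z : β → AddMonoidAlgebra R (Multiset β') := fun a =>
    single (((p a).map fun b => ({b} : Multiset β')).getD 0) (w a)
  -- Including `N` itself ensures that `N` is among the multisets over `B` even when some label in
  -- it is attained by no `a`.
  let B : Finset β' := A.biUnion (fun a => (p a).toFinset) ∪ N.toFinset
  let S : β' → R := fun b => ∑ a ∈ A with p a = some b, w a
  let S0 : R := ∑ a ∈ A with p a = none, w a
  have hz : ∀ D : Multiset β, (D.map z).prod = single (D.filterMap p) (D.map w).prod := by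
    intro D
    induction D using Multiset.induction with
    | empty => simp [one_def]
    | cons a D ih =>
      rw [Multiset.map_cons, Multiset.prod_cons, ih, Multiset.filterMap_cons, Multiset.map_cons,
        Multiset.prod_cons]
      exact single_mul_single ..
  have hS : ∀ M : Multiset β', (M.map fun b => single ({b} : Multiset β') (S b)).prod =
      single M (M.map S).prod := by
    intro M
    induction M using Multiset.induction with
    | empty => simp [one_def]
    | cons a D ih =>
      rw [Multiset.map_cons, Multiset.prod_cons, ih, Multiset.map_cons, Multiset.prod_cons,
        single_mul_single, Multiset.singleton_add]
  have hsum : ∑ a ∈ A, z a = single 0 S0 + ∑ b ∈ B, single ({b} : Multiset β') (S b) := by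
    rw [← Finset.sum_filter_add_sum_filter_not A (fun a => p a = none)]
    congr 1
    · rw [← singleAddHom_apply, map_sum]
      refine Finset.sum_congr rfl fun a ha => ?_
      simp only [z, (Finset.mem_filter.1 ha).2]
      rfl
    · have : ∀ b ∈ B, single ({b} : Multiset β') (S b) = ∑ a ∈ A with p a = some b, z a := by
        intro b _
        rw [← singleAddHom_apply, map_sum]
        refine Finset.sum_congr rfl fun a ha => ?_
        simp only [z, (Finset.mem_filter.1 ha).2]
        rfl
      rw [Finset.sum_congr rfl this, Finset.sum_comm' (t' := A.filter fun a => p a ≠ none)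
        (s' := fun a => (p a).toFinset)]
      · refine Finset.sum_congr rfl fun a ha => ?_
        obtain ⟨b, hb⟩ := Option.ne_none_iff_exists'.1 (Finset.mem_filter.1 ha).2
        simp [hb]
      · intro b a
        simp only [Finset.mem_filter, Option.mem_toFinset, Option.mem_def, B, Finset.mem_union,
          Finset.mem_biUnion]
        constructor
        · rintro ⟨_, ha, hb⟩
          exact ⟨hb, ha, by simp [hb]⟩
        · rintro ⟨hb, ha, _⟩
          exact ⟨Or.inl ⟨a, ha, hb⟩, ha, hb⟩
  have h1 := sum_pow_div_factorial A z n
  have hT : ∀ j, ((∑ b ∈ B, single ({b} : Multiset β') (S b)) ^ j).coeff N =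
      if j = k then ((k.factorial : ℝ) * (symFactor N : ℝ)⁻¹) • (N.map S).prod else 0 := by
    intro j
    have hj : ((j.factorial : ℝ)) ≠ 0 := by exact_mod_cast j.factorial_ne_zero
    have h2 := sum_pow_div_factorial B (fun b => single ({b} : Multiset β') (S b)) j
    rw [inv_smul_eq_iff₀ hj] at h2
    rw [h2, coeff_smul, coeff_sum, Finsupp.smul_apply, Finsupp.finsetSum_apply]
    simp only [hS, coeff_smul, coeff_single, Finsupp.smul_apply, Finsupp.single_apply]
    split_ifs with hjk
    · rw [Finset.sum_eq_single_of_mem N (mem_multisetsOf.2 ⟨hjk ▸ hk.symm, fun b hb => by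
        simp [B, hb]⟩), if_pos rfl, smul_smul, hjk]
      intro M _ hM
      rw [if_neg hM, smul_zero]
    · rw [Finset.sum_eq_zero, smul_zero]
      intro M hM
      rw [if_neg, smul_zero]
      rintro rfl
      exact hjk (mem_multisetsOf.1 hM).1.symm
  rw [hsum, add_pow] at h1
  have h3 := congrArg (fun x => x.coeff N) h1
  simp only [coeff_smul, coeff_sum, Finsupp.smul_apply, Finsupp.finsetSum_apply, hz,
    coeff_single] at h3
  have h4 : ∀ D : Multiset β, ((symFactor D : ℝ)⁻¹ • (Finsupp.single (D.filterMap p)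
      (D.map w).prod : Multiset β' →₀ R) N) = if D.filterMap p = N then
        (symFactor D : ℝ)⁻¹ • (D.map w).prod else 0 := by
    intro D
    rw [Finsupp.single_apply]
    split_ifs <;> simp
  simp only [h4] at h3
  rw [← Finset.sum_filter] at h3
  rw [← h3]
  have h5 : ∀ i, ((single (0 : Multiset β') S0 ^ i * (∑ b ∈ B, single ({b} : Multiset β') (S b)) ^
      (n - i) * (n.choose i : AddMonoidAlgebra R (Multiset β'))).coeff N) =
      if n - i = k then ((n.choose i : ℝ) * ((k.factorial : ℝ) * (symFactor N : ℝ)⁻¹)) •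
        (S0 ^ i * (N.map S).prod) else 0 := by
    intro i
    rw [natCast_def, coeff_mul_single_zero, single_pow, smul_zero, coeff_single_zero_mul, hT]
    split_ifs
    · rw [mul_smul_comm, mul_comm _ (n.choose i : R), ← nsmul_eq_mul, ← Nat.cast_smul_eq_nsmul ℝ,
        smul_smul]
    · rw [mul_zero, zero_mul]
  simp only [h5]
  -- Within the range i ≤ n, n - i = k forces i = r; the bound is needed because the subtraction is
  -- truncated.
  rw [Finset.sum_eq_single_of_mem r (Finset.mem_range.2 (by omega)), if_pos (by omega), smul_smul]
  · congr 1
    have := Nat.add_choose_mul_factorial_mul_factorial k r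
    have h6 : ((n.choose r : ℝ)) * (r.factorial * k.factorial) = n.factorial := by
      rw [hn, ← this]
      push_cast
      ring
    have h7 : (n.factorial : ℝ) ≠ 0 := by exact_mod_cast n.factorial_ne_zero
    have h8 : (r.factorial : ℝ) ≠ 0 := by exact_mod_cast r.factorial_ne_zero
    field_simp
    rw [← h6]
    ring
  · intro i hi hne
    rw [Finset.mem_range] at hi
    rw [if_neg (by omega)]

end Exponential
-- Mixed directional derivatives along multisets of vectors
section DirectionalDerivatives

variable {E G : Type*} [NormedAddCommGroup E] [NormedSpace ℝ E] [NormedAddCommGroup G]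
  [NormedSpace ℝ G]

/-- The iterated directional derivative of `f` along the vectors of a list. -/
noncomputable def dlist (f : E → G) : List E → E → G
  | [] => f
  | v :: L => fun x => fderiv ℝ (dlist f L) x v

variable {f : E → G}

theorem contDiff_dlist (hf : ContDiff ℝ ((⊤ : ℕ∞) : WithTop ℕ∞) f) (L : List E) :
    ContDiff ℝ ((⊤ : ℕ∞) : WithTop ℕ∞) (dlist f L) := by
  induction L with
  | nil => exact hf
  | cons v L ih => exact (ih.fderiv_right (m := ((⊤ : ℕ∞) : WithTop ℕ∞)) (by simp)).clm_apply contDiff_const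

theorem dlist_eq (hf : ContDiff ℝ ((⊤ : ℕ∞) : WithTop ℕ∞) f) (L : List E) (x : E) :
    dlist f L x = iteratedFDeriv ℝ L.length f x L.get := by
  induction L generalizing x with
  | nil => simp [dlist]
  | cons v L ih =>
    have h : DifferentiableAt ℝ (iteratedFDeriv ℝ L.length f) x :=
      (hf.differentiable_iteratedFDeriv (by exact_mod_cast WithTop.coe_lt_top _)).differentiableAt
    refine Eq.trans ?_ (h.iteratedFDeriv_succ_apply_left' (m := (v :: L).get)).symm
    have : dlist f L = fun y => iteratedFDeriv ℝ L.length f y (Fin.tail (v :: L).get) :=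
      funext fun y => ih y
    rw [dlist, this]
    rfl

/-- Symmetry of the second derivative handles adjacent swaps. This is what makes derivatives along
multisets, hence along unordered branches, meaningful. -/
theorem dlist_perm (hf : ContDiff ℝ ((⊤ : ℕ∞) : WithTop ℕ∞) f) {L L' : List E} (h : L.Perm L') :
    dlist f L = dlist f L' := by
  induction h with
  | nil => rfl
  | cons v _ ih => funext x; rw [dlist, dlist, ih]
  | swap v w L =>
    funext x
    have hL := contDiff_dlist hf L
    have h1 : DifferentiableAt ℝ (fderiv ℝ (dlist f L)) x :=
      ((hL.fderiv_right (m := ((⊤ : ℕ∞) : WithTop ℕ∞)) (by simp)).differentiable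
        (by simp)).differentiableAt
    have hs : IsSymmSndFDerivAt ℝ (dlist f L) x :=
      hL.contDiffAt.isSymmSndFDerivAt (by
        simpa using WithTop.coe_le_coe.2 (le_top : (2 : ℕ∞) ≤ ⊤))
    have key : ∀ a b : E, dlist f (a :: b :: L) x = fderiv ℝ (fderiv ℝ (dlist f L)) x a b := by
      intro a b
      change fderiv ℝ (fun y => fderiv ℝ (dlist f L) y b) x a = _
      rw [fderiv_clm_apply h1 (differentiableAt_const b)]
      simp
    rw [key, key]
    exact hs.eq _ _
  | trans _ _ ih1 ih2 => exact ih1.trans ih2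

/-- The iterated directional derivative of `f` along the vectors of a multiset. -/
noncomputable def dmul (f : E → G) (M : Multiset E) (x : E) : G := dlist f M.toList x

theorem dmul_coe (hf : ContDiff ℝ ((⊤ : ℕ∞) : WithTop ℕ∞) f) (L : List E) :
    dmul f (L : Multiset E) = dlist f L := by
  funext x
  rw [dmul, dlist_perm hf (Multiset.coe_eq_coe.1 (Multiset.coe_toList (L : Multiset E)))]

theorem dmul_zero : dmul f 0 = f := by
  funext x
  simp [dmul, dlist]

theorem dmul_cons (hf : ContDiff ℝ ((⊤ : ℕ∞) : WithTop ℕ∞) f) (v : E) (M : Multiset E) :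
    dmul f (v ::ₘ M) = fun x => fderiv ℝ (dmul f M) x v := by
  induction M using Quotient.inductionOn with
  | h L =>
    have h1 := dmul_coe hf (v :: L)
    have h2 := dmul_coe hf L
    exact h1.trans (by rw [dlist, ← h2]; rfl)

theorem contDiff_dmul (hf : ContDiff ℝ ((⊤ : ℕ∞) : WithTop ℕ∞) f) (M : Multiset E) :
    ContDiff ℝ ((⊤ : ℕ∞) : WithTop ℕ∞) (dmul f M) := contDiff_dlist hf _

theorem dmul_ofFn (hf : ContDiff ℝ ((⊤ : ℕ∞) : WithTop ℕ∞) f) {n : ℕ} (v : Fin n → E) (x : E) :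
    dmul f (List.ofFn v : Multiset E) x = iteratedFDeriv ℝ n f x v := by
  rw [dmul_coe hf, dlist_eq hf]
  have : ∀ (k : ℕ) (hk : k = n) (w : Fin k → E), (∀ i, w i = v (Fin.cast hk i)) →
      iteratedFDeriv ℝ k f x w = iteratedFDeriv ℝ n f x v := by
    rintro k rfl w hw
    congr 1
    funext i
    exact hw i
  refine this _ (List.length_ofFn) _ fun i => ?_
  simp only [List.get_eq_getElem, List.getElem_ofFn]
  rfl

theorem dmul_smul_map (hf : ContDiff ℝ ((⊤ : ℕ∞) : WithTop ℕ∞) f) {ι : Type*}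
    (c : ι → ℝ) (a : ι → E) (M : Multiset ι) (N : Multiset E) (x : E) :
    dmul f (N + M.map fun i => c i • a i) x = (M.map c).prod • dmul f (N + M.map a) x := by
  induction M using Multiset.induction generalizing N with
  | empty => simp
  | cons i M ih =>
    rw [Multiset.map_cons, Multiset.add_cons, dmul_cons hf]
    simp only [map_smul, Multiset.map_cons, Multiset.prod_cons]
    rw [mul_smul, Multiset.add_cons, ← Multiset.cons_add, ← ih, Multiset.cons_add, dmul_cons hf]

theorem norm_dmul_le (hf : ContDiff ℝ ((⊤ : ℕ∞) : WithTop ℕ∞) f) (M : Multiset E) (x : E)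
    (k : ℕ) (hk : M.card = k) :
    ‖dmul f M x‖ ≤ ‖iteratedFDeriv ℝ k f x‖ * (M.map norm).prod := by
  subst hk
  induction M using Quotient.inductionOn with
  | h L =>
    change ‖dmul f (L : Multiset E) x‖ ≤ ‖iteratedFDeriv ℝ L.length f x‖ *
      (Multiset.map norm (L : Multiset E)).prod
    rw [dmul_coe hf, dlist_eq hf]
    refine ((iteratedFDeriv ℝ L.length f x).le_opNorm _).trans (le_of_eq ?_)
    rw [Multiset.map_coe, Multiset.prod_coe]
    congr 1
    exact Fin.prod_univ_fun_getElem L norm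

end DirectionalDerivatives

/-! ### Regularity of elementary differentials -/

section Elementary

variable {d m : ℕ} {g : Fin (m + 1) → EuclideanSpace ℝ (Fin d) → EuclideanSpace ℝ (Fin d)}

theorem NTree.F_eq (hg : ∀ l, ContDiff ℝ ((⊤ : ℕ∞) : WithTop ℕ∞) (g l)) (τ : NTree m)
    (x : EuclideanSpace ℝ (Fin d)) :
    NTree.F g τ x = dmul (g τ.root) (τ.children.map fun t => NTree.F g t x) x := by
  have h : (τ.children.map fun t => NTree.F g t x) =
      (List.ofFn fun i => NTree.F g (τ.children.toList.get i) x : Multiset _) := by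
    conv_lhs => rw [← Multiset.coe_toList τ.children, Multiset.map_coe]
    congr 1
    exact (List.ofFn_getElem_eq_map _ _).symm
  rw [h, dmul_ofFn (hg _), NTree.F]

theorem NTree.contDiff_F (hg : ∀ l, ContDiff ℝ ((⊤ : ℕ∞) : WithTop ℕ∞) (g l)) (τ : NTree m) :
    ContDiff ℝ ((⊤ : ℕ∞) : WithTop ℕ∞) (NTree.F g τ) := by
  induction τ using NTree.induction with
  | h τ ih =>
    have : NTree.F g τ = fun x => iteratedFDeriv ℝ τ.children.toList.length (g τ.root) x
        fun i => NTree.F g (τ.children.toList.get i) x := funext fun x => by rw [NTree.F]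
    rw [this]
    have h1 := ((ContinuousLinearMap.id ℝ (ContinuousMultilinearMap ℝ
      (fun _ : Fin τ.children.toList.length => EuclideanSpace ℝ (Fin d))
      (EuclideanSpace ℝ (Fin d)))).analyticOnNhd_uncurry_of_multilinear
        (s := Set.univ)).contDiff (n := ((⊤ : ℕ∞) : WithTop ℕ∞))
    exact h1.comp (((hg τ.root).iteratedFDeriv_right
      (by exact_mod_cast (le_top : (⊤ : ℕ∞) + (τ.children.toList.length : ℕ∞) ≤ ⊤))).prodMk
      (contDiff_pi.2 fun i => ih _ (Multiset.mem_toList.1 (List.get_mem _ i))))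

theorem NTree.analyticOnNhd_F (hg : ∀ l, AnalyticOnNhd ℝ (g l) Set.univ) (τ : NTree m) :
    AnalyticOnNhd ℝ (NTree.F g τ) Set.univ := by
  induction τ using NTree.induction with
  | h τ ih =>
    have : NTree.F g τ = fun x => iteratedFDeriv ℝ τ.children.toList.length (g τ.root) x
        fun i => NTree.F g (τ.children.toList.get i) x := funext fun x => by rw [NTree.F]
    rw [this]
    intro x _
    have h1 := (ContinuousLinearMap.id ℝ (ContinuousMultilinearMap ℝ
      (fun _ : Fin τ.children.toList.length => EuclideanSpace ℝ (Fin d))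
      (EuclideanSpace ℝ (Fin d)))).analyticOnNhd_uncurry_of_multilinear (s := Set.univ)
    exact (h1 _ trivial).comp (((hg τ.root).iteratedFDeriv _ x trivial).prod
      (AnalyticAt.pi fun i => ih _ (Multiset.mem_toList.1 (List.get_mem _ i)) x trivial))

end Elementary
-- Taylor estimates and uniqueness of asymptotic expansions
section Taylor

open Filter Topology Asymptotics

variable {E G : Type*} [NormedAddCommGroup E] [NormedSpace ℝ E] [NormedAddCommGroup G]
  [NormedSpace ℝ G] {f : E → G}

theorem iteratedDeriv_dmul (hf : ContDiff ℝ ((⊤ : ℕ∞) : WithTop ℕ∞) f) (Q : Multiset E)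
    (x w : E) (r : ℕ) :
    iteratedDeriv r (fun s : ℝ => dmul f Q (x + s • w)) =
      fun s => dmul f (Multiset.replicate r w + Q) (x + s • w) := by
  induction r with
  | zero => simp [iteratedDeriv_zero]
  | succ r ih =>
    rw [iteratedDeriv_succ, ih]
    funext s
    have h1 : HasDerivAt (fun s : ℝ => x + s • w) w s := by
      simpa using ((hasDerivAt_id s).smul_const w).const_add x
    have h2 := ((contDiff_dmul hf (Multiset.replicate r w + Q)).differentiable
      (by simp) (x + s • w)).hasFDerivAt
    have h3 : HasDerivAt (fun s : ℝ => dmul f (Multiset.replicate r w + Q) (x + s • w)) _ s :=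
      h2.comp_hasDerivAt s h1
    rw [h3.deriv, Multiset.replicate_succ, Multiset.cons_add, dmul_cons hf]

/-- One-variable Taylor along the segment from x to x + w: each derivative in s adds a copy of w to
the directions. The factor 1/N! of the remainder is discarded. -/
theorem norm_dmul_sub_taylor_le (hf : ContDiff ℝ ((⊤ : ℕ∞) : WithTop ℕ∞) f) (Q : Multiset E)
    (x w : E) (N : ℕ) (C : ℝ)
    (hC : ∀ s ∈ Set.Icc (0 : ℝ) 1, ‖dmul f (Multiset.replicate (N + 1) w + Q) (x + s • w)‖ ≤ C) :
    ‖dmul f Q (x + w) - ∑ r ∈ Finset.range (N + 1),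
      ((r.factorial : ℝ)⁻¹) • dmul f (Multiset.replicate r w + Q) x‖ ≤ C := by
  have hψ : ContDiff ℝ ((⊤ : ℕ∞) : WithTop ℕ∞) fun s : ℝ => dmul f Q (x + s • w) :=
    (contDiff_dmul hf Q).comp (contDiff_const.add (contDiff_id.smul contDiff_const))
  have hd : ∀ n : ℕ, ∀ s ∈ Set.Icc (0 : ℝ) 1, iteratedDerivWithin n
      (fun s : ℝ => dmul f Q (x + s • w)) (Set.Icc 0 1) s =
        dmul f (Multiset.replicate n w + Q) (x + s • w) := by
    intro n s hs
    rw [iteratedDerivWithin_eq_iteratedDeriv (uniqueDiffOn_Icc one_pos)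
      ((hψ.of_le (by exact_mod_cast le_top)).contDiffAt) hs, iteratedDeriv_dmul hf]
  have h := taylor_mean_remainder_bound (n := N) (x := 1) (C := C) zero_le_one
    (hψ.of_le (by exact_mod_cast le_top)).contDiffOn (Set.right_mem_Icc.2 zero_le_one)
    fun s hs => by rw [hd _ s hs]; exact hC s hs
  rw [taylor_within_apply] at h
  have hC0 : 0 ≤ C := (norm_nonneg _).trans (hC 0 (Set.left_mem_Icc.2 zero_le_one))
  refine le_trans (le_of_eq ?_) (h.trans ?_)
  · rw [one_smul]
    congr 2
    refine Finset.sum_congr rfl fun r _ => ?_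
    rw [hd r 0 (Set.left_mem_Icc.2 zero_le_one)]
    simp
  · simp only [sub_zero, one_pow, mul_one]
    exact div_le_self hC0 (by exact_mod_cast Nat.one_le_iff_ne_zero.2 N.factorial_ne_zero)

theorem isBigO_multiset_prod {H : Type*} [NormedAddCommGroup H] {ι : Type*} (U : ι → ℝ → H) (Q : Multiset ι)
    (hU : ∀ i ∈ Q, U i =O[𝓝 0] fun _ => (1 : ℝ)) :
    (fun t => ((Q.map fun i => U i t).map norm).prod) =O[𝓝 0] fun _ => (1 : ℝ) := by
  induction Q using Multiset.induction with
  | empty => simpa using isBigO_refl (fun _ : ℝ => (1 : ℝ)) (𝓝 0)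
  | cons i Q ih =>
    simp only [Multiset.map_cons, Multiset.prod_cons]
    simpa using (hU i (Multiset.mem_cons_self _ _)).norm_left.mul
      (ih fun j hj => hU j (Multiset.mem_cons_of_mem hj))

theorem isBigO_dmul_sub_taylor (hf : ContDiff ℝ ((⊤ : ℕ∞) : WithTop ℕ∞) f) {ι : Type*}
    (U : ι → ℝ → E) (Q : Multiset ι) (hU : ∀ i ∈ Q, U i =O[𝓝 0] fun _ => (1 : ℝ)) (x : E)
    (w : ℝ → E) (hw : w =O[𝓝 0] fun t => t) (N : ℕ) :
    (fun t => dmul f (Q.map fun i => U i t) (x + w t) - ∑ r ∈ Finset.range (N + 1),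
      ((r.factorial : ℝ)⁻¹) • dmul f (Multiset.replicate r (w t) + Q.map fun i => U i t) x)
        =O[𝓝 0] fun t => t ^ (N + 1) := by
  -- k is the number of directions in the remainder. By continuity the k-th derivative stays below
  -- `B` on a ball about x, which contains the segment to x + w(t) for small t.
  set k := N + 1 + Q.card with hk
  set B := ‖iteratedFDeriv ℝ k f x‖ + 1 with hB
  have hcont : Continuous fun y => ‖iteratedFDeriv ℝ k f y‖ :=
    (hf.continuous_iteratedFDeriv (by exact_mod_cast le_top)).norm
  obtain ⟨δ, hδ, hball⟩ := Metric.eventually_nhds_iff_ball.1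
    (hcont.continuousAt.eventually (gt_mem_nhds (lt_add_one ‖iteratedFDeriv ℝ k f x‖)))
  have hw0 : Tendsto w (𝓝 0) (𝓝 0) := hw.trans_tendsto tendsto_id
  have hsmall : ∀ᶠ t in 𝓝 (0 : ℝ), ‖w t‖ < δ := by
    have := hw0.norm
    rw [norm_zero] at this
    exact this.eventually (gt_mem_nhds hδ)
  have h1 : (fun t => B * (‖w t‖ ^ (N + 1) * ((Q.map fun i => U i t).map norm).prod))
      =O[𝓝 0] fun t => t ^ (N + 1) := by
    refine IsBigO.const_mul_left ?_ B
    simpa using (hw.norm_left.pow (N + 1)).mul (isBigO_multiset_prod U Q hU)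
  refine IsBigO.trans (IsBigO.of_bound 1 ?_) h1
  filter_upwards [hsmall] with t ht
  rw [one_mul]
  refine (norm_dmul_sub_taylor_le hf _ x (w t) N _ fun s hs => ?_).trans (le_abs_self _)
  refine (norm_dmul_le hf _ _ k (by simp [hk]; omega)).trans ?_
  simp only [Multiset.map_add,
    Multiset.prod_add, Multiset.map_replicate, Multiset.prod_replicate]
  refine mul_le_mul_of_nonneg_right (hball (x + s • w t) ?_).le ?_
  · rw [Metric.mem_ball, dist_eq_norm, add_sub_cancel_left, norm_smul]
    refine lt_of_le_of_lt (mul_le_of_le_one_left (norm_nonneg _) ?_) ht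
    rw [Real.norm_eq_abs, abs_of_nonneg hs.1]
    exact hs.2
  · refine mul_nonneg (by positivity) (Multiset.prod_nonneg fun a ha => ?_)
    obtain ⟨b, -, rfl⟩ := Multiset.mem_map.1 ha
    exact norm_nonneg _

/-- Multilinearity: the entries are exchanged one at a time. `R` holds the entries already settled
and is generalized for the induction. -/
theorem isBigO_dmul_sub_dmul (hf : ContDiff ℝ ((⊤ : ℕ∞) : WithTop ℕ∞) f) {ι : Type*}
    (U V : ι → ℝ → E) (Q : Multiset ι) (N : ℕ) (x : E)
    (hU : ∀ i ∈ Q, U i =O[𝓝 0] fun _ => (1 : ℝ)) (hV : ∀ i ∈ Q, V i =O[𝓝 0] fun _ => (1 : ℝ))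
    (hUV : ∀ i ∈ Q, (fun t => U i t - V i t) =O[𝓝 0] fun t => t ^ N)
    (R : Multiset (ℝ → E)) (hR : ∀ u ∈ R, u =O[𝓝 0] fun _ => (1 : ℝ)) :
    (fun t => dmul f ((R.map fun u => u t) + Q.map fun i => U i t) x -
      dmul f ((R.map fun u => u t) + Q.map fun i => V i t) x) =O[𝓝 0] fun t => t ^ N := by
  induction Q using Multiset.induction generalizing R with
  | empty => simpa using isBigO_zero (fun t : ℝ => t ^ N) (𝓝 0)
  | cons i Q ih =>
    have hi := Multiset.mem_cons_self i Q
    have hQ : ∀ j ∈ Q, j ∈ i ::ₘ Q := fun j hj => Multiset.mem_cons_of_mem hj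
    have h1 := ih (fun j hj => hU j (hQ j hj)) (fun j hj => hV j (hQ j hj))
      (fun j hj => hUV j (hQ j hj)) (U i ::ₘ R) fun u hu => by
        rcases Multiset.mem_cons.1 hu with rfl | hu
        exacts [hU i hi, hR u hu]
    have h2 : (fun t => dmul f ((U i t - V i t) ::ₘ
        ((R.map fun u => u t) + Q.map fun i => V i t)) x) =O[𝓝 0] fun t => t ^ N := by
      have h3 := isBigO_multiset_prod (fun u : ℝ → E => u) (R + Q.map V) fun u hu => by
        rcases Multiset.mem_add.1 hu with hu | hu
        · exact hR u hu
        · obtain ⟨j, hj, rfl⟩ := Multiset.mem_map.1 hu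
          exact hV j (hQ j hj)
      have h4 := (((hUV i hi).norm_left.mul h3).const_mul_left
        ‖iteratedFDeriv ℝ (R.card + Q.card + 1) f x‖)
      simp only [mul_one] at h4
      refine IsBigO.trans (IsBigO.of_bound 1 (Eventually.of_forall fun t => ?_)) h4
      rw [one_mul]
      refine (norm_dmul_le hf _ _ (R.card + Q.card + 1) (by simp)).trans
        (le_trans (le_of_eq ?_) (le_abs_self _))
      simp only [Multiset.map_cons,
        Multiset.prod_cons, Multiset.map_add, Multiset.map_map, Function.comp_def]
    refine (h1.add h2).congr_left fun t => ?_
    simp only [Multiset.map_cons, Multiset.add_cons, Multiset.cons_add, dmul_cons hf, map_sub]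
    abel

theorem dmul_replicate (hf : ContDiff ℝ ((⊤ : ℕ∞) : WithTop ℕ∞) f) (r : ℕ) (w x : E) :
    dmul f (Multiset.replicate r w) x = iteratedFDeriv ℝ r f x fun _ => w := by
  rw [← dmul_ofFn hf, List.ofFn_const]
  rfl

/-- Taylor expansion along a finite sum of monomials. -/
theorem isBigO_sub_taylor_sum (hf : ContDiff ℝ ((⊤ : ℕ∞) : WithTop ℕ∞) f) {ι : Type*}
    [DecidableEq ι] (s : Finset ι) (e : ι → ℕ) (he : ∀ i ∈ s, 0 < e i) (a : ι → E) (x : E)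
    (N : ℕ) :
    (fun t : ℝ => f (x + ∑ i ∈ s, t ^ e i • a i) -
      ∑ q ∈ (Finset.range (N + 1)).sigma fun r => Fintype.piFinset fun _ : Fin r => s,
        t ^ (∑ j, e (q.2 j)) • ((q.1.factorial : ℝ)⁻¹) • iteratedFDeriv ℝ q.1 f x fun j => a (q.2 j))
      =O[𝓝 0] fun t => t ^ (N + 1) := by
  have hw : (fun t : ℝ => ∑ i ∈ s, t ^ e i • a i) =O[𝓝 0] fun t => t := by
    refine IsBigO.fun_sum fun i hi => ?_
    obtain ⟨n, hn⟩ := Nat.exists_eq_succ_of_ne_zero (he i hi).ne'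
    have h1 : (fun t : ℝ => t ^ n • a i) =O[𝓝 0] fun _ => (1 : ℝ) :=
      ((by fun_prop : Continuous fun t : ℝ => t ^ n • a i).tendsto 0).isBigO_one ℝ
    have h2 := (isBigO_refl (fun t : ℝ => t) (𝓝 0)).smul h1
    simp only [smul_eq_mul, mul_one, smul_smul, ← pow_succ'] at h2
    rw [hn]
    exact h2
  have h := isBigO_dmul_sub_taylor hf (fun _ _ => 0) (0 : Multiset ι) (by simp) x _ hw N
  refine h.congr_left fun t => ?_
  simp only [Multiset.map_zero, add_zero, dmul_zero, dmul_replicate hf]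
  congr 1
  rw [Finset.sum_sigma]
  refine Finset.sum_congr rfl fun r _ => ?_
  rw [ContinuousMultilinearMap.map_sum_finset, Finset.smul_sum]
  refine Finset.sum_congr rfl fun v _ => ?_
  rw [ContinuousMultilinearMap.map_smul_univ, Finset.prod_pow_eq_pow_sum, smul_comm]

theorem isBigO_pow_of_le {j k : ℕ} (hjk : k ≤ j) :
    (fun t : ℝ => t ^ j) =O[𝓝 0] fun t => t ^ k := by
  obtain ⟨i, rfl⟩ := Nat.exists_eq_add_of_le hjk
  have h1 : (fun t : ℝ => t ^ i) =O[𝓝 0] fun _ => (1 : ℝ) :=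
    ((continuous_pow i).tendsto 0).isBigO_one ℝ
  simpa [pow_add] using (isBigO_refl (fun t : ℝ => t ^ k) (𝓝 0)).mul h1

/-- Coefficients of a polynomial asymptotic expansion are unique. -/
theorem sum_eq_zero_of_isBigO {ι : Type*} (s : Finset ι) (e : ι → ℕ) (a : ι → E) (N : ℕ)
    (h : (fun t : ℝ => ∑ i ∈ s, t ^ e i • a i) =O[𝓝 0] fun t => t ^ (N + 1)) (n : ℕ)
    (hn : n ≤ N) : ∑ i ∈ s with e i = n, a i = 0 := by
  induction n using Nat.strong_induction_on with
  | _ n ih =>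
    set c := ∑ i ∈ s with e i = n, a i with hc
    have h1 : (fun t : ℝ => t ^ n • c) =O[𝓝 0] fun t => t ^ (n + 1) := by
      have h2 : (fun t : ℝ => ∑ i ∈ s with n < e i, t ^ e i • a i) =O[𝓝 0]
          fun t => t ^ (n + 1) := by
        refine IsBigO.fun_sum fun i hi => ?_
        have := (isBigO_pow_of_le (Nat.succ_le_of_lt (Finset.mem_filter.1 hi).2)).smul
          (isBigO_refl (fun _ : ℝ => a i) (𝓝 0))
        refine this.trans ?_
        simpa using (isBigO_refl (fun t : ℝ => t ^ (n + 1)) (𝓝 0)).smul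
          (isBigO_const_const (a i) (one_ne_zero (α := ℝ)) (𝓝 (0 : ℝ)))
      refine ((h.trans (isBigO_pow_of_le (by omega))).sub h2).congr_left fun t => ?_
      have h3 : ∑ i ∈ s with e i < n, t ^ e i • a i = 0 := by
        rw [← Finset.sum_fiberwise_of_maps_to (t := Finset.range n) (g := e)
          fun i hi => Finset.mem_range.2 (Finset.mem_filter.1 hi).2]
        refine Finset.sum_eq_zero fun j hj => ?_
        have hj' := Finset.mem_range.1 hj
        have h4 : ∑ i ∈ (s.filter fun i => e i < n) with e i = j, t ^ e i • a i =
            t ^ j • ∑ i ∈ s with e i = j, a i := by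
          rw [Finset.smul_sum, Finset.filter_filter]
          refine Finset.sum_congr (Finset.filter_congr fun i _ => ⟨fun h => h.2, fun h =>
            ⟨by omega, h⟩⟩) fun i hi => by rw [(Finset.mem_filter.1 hi).2]
        rw [h4, ih j hj' (by omega), smul_zero]
      have h5 : ∑ i ∈ s with e i = n, t ^ e i • a i = t ^ n • c := by
        rw [hc, Finset.smul_sum]
        exact Finset.sum_congr rfl fun i hi => by rw [(Finset.mem_filter.1 hi).2]
      rw [← Finset.sum_filter_add_sum_filter_not s (fun i => n < e i), add_sub_cancel_left,
        ← Finset.sum_filter_add_sum_filter_not _ (fun i => e i = n), Finset.filter_filter,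
        Finset.filter_filter, ← h5]
      rw [Finset.filter_congr (q := fun i => e i = n) fun i _ => ⟨fun h => h.2, fun h => ⟨by omega, h⟩⟩,
        Finset.filter_congr (p := fun i => ¬n < e i ∧ ¬e i = n) (q := fun i => e i < n)
          fun i _ => ⟨fun h => by omega, fun h => by omega⟩, h3, add_zero]
    obtain ⟨K, hK⟩ := h1.bound
    -- All lower coefficients vanish by induction, so t^n c = O(t^(n+1)); dividing by t^n and
    -- letting t decrease to 0 gives c = 0.
    have h6 : ∀ᶠ t in 𝓝[>] (0 : ℝ), ‖c‖ ≤ K * t := by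
      filter_upwards [hK.filter_mono nhdsWithin_le_nhds, self_mem_nhdsWithin] with t ht ht0
      have ht0' : 0 < t := ht0
      rw [norm_smul, norm_pow, norm_pow, Real.norm_eq_abs, abs_of_pos ht0', pow_succ] at ht
      have hp : 0 < t ^ n := pow_pos ht0' n
      refine le_of_mul_le_mul_left (ht.trans (le_of_eq (by ring))) hp
    have h7 : Tendsto (fun t : ℝ => K * t) (𝓝[>] 0) (𝓝 0) := by
      have : Tendsto (fun t : ℝ => K * t) (𝓝 0) (𝓝 (K * 0)) := (continuous_const_mul K).tendsto 0
      rw [mul_zero] at this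
      exact this.mono_left nhdsWithin_le_nhds
    exact norm_le_zero_iff.1 (ge_of_tendsto h7 h6)

end Taylor
-- Expanding mixed derivatives along sums
section Expansion

variable {E G : Type*} [NormedAddCommGroup E] [NormedSpace ℝ E] [NormedAddCommGroup G]
  [NormedSpace ℝ G] {f : E → G}

/-- The linear map on formal combinations of multisets of vectors given by the iterated
derivatives of `f` at `x`. -/
noncomputable def dmulLinear (f : E → G) (x : E) : AddMonoidAlgebra ℝ (Multiset E) →ₗ[ℝ] G :=
  (Finsupp.linearCombination ℝ fun M => dmul f M x) ∘ₗ
    (AddMonoidAlgebra.coeffLinearEquiv ℝ).toLinearMap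

theorem dmulLinear_single (x : E) (M : Multiset E) (r : ℝ) :
    dmulLinear f x (AddMonoidAlgebra.single M r) = r • dmul f M x := by
  simp [dmulLinear]

/-- Products of monomials become lists of directions, so identities in the commutative algebra, such
as `sum_filterMap_eq`, transfer to mixed derivatives. -/
theorem dmulLinear_prod_sum (hf : ContDiff ℝ ((⊤ : ℕ∞) : WithTop ℕ∞) f) {ι β : Type*} (x : E)
    (Q : Multiset ι) (s : ι → Finset β) (u : β → E) (P : Multiset E) :
    dmulLinear f x (AddMonoidAlgebra.single P 1 *
      (Q.map fun j => ∑ b ∈ s j, AddMonoidAlgebra.single ({u b} : Multiset E) (1 : ℝ)).prod) =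
      dmul f (P + Q.map fun j => ∑ b ∈ s j, u b) x := by
  induction Q using Multiset.induction generalizing P with
  | empty => simp [dmulLinear_single]
  | cons j Q ih =>
    simp only [Multiset.map_cons, Multiset.prod_cons]
    rw [← mul_assoc, Finset.mul_sum, Finset.sum_mul, map_sum, Multiset.add_cons, dmul_cons hf]
    simp only [map_sum]
    refine Finset.sum_congr rfl fun b _ => ?_
    rw [AddMonoidAlgebra.single_mul_single, mul_one, ih, add_comm P, Multiset.singleton_add,
      Multiset.cons_add, dmul_cons hf]

/-- Expansion of a mixed derivative along sums of vectors, collected by the multisets of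
summands. -/
theorem dmul_sum_expand (hf : ContDiff ℝ ((⊤ : ℕ∞) : WithTop ℕ∞) f) {β β' : Type*}
    [DecidableEq β] [DecidableEq β'] (A : Finset β) (p : β → Option β') (u : β → E) (x : E)
    (N : Multiset β') (r : ℕ) :
    ((r.factorial : ℝ)⁻¹ * (symFactor N : ℝ)⁻¹) •
      dmul f (Multiset.replicate r (∑ b ∈ A with p b = none, u b) +
        N.map fun j => ∑ b ∈ A with p b = some j, u b) x =
      ∑ D ∈ multisetsOf A (N.card + r) with D.filterMap p = N,
        ((symFactor D : ℝ)⁻¹) • dmul f (D.map u) x := by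
  have h := congrArg (dmulLinear f x) (sum_filterMap_eq A p
    (fun b => AddMonoidAlgebra.single ({u b} : Multiset E) (1 : ℝ)) N r)
  have h1 : ∀ D : Multiset β, (D.map fun b => AddMonoidAlgebra.single ({u b} : Multiset E)
      (1 : ℝ)).prod = AddMonoidAlgebra.single (D.map u) 1 := by
    intro D
    induction D using Multiset.induction with
    | empty => simp [AddMonoidAlgebra.one_def]
    | cons a D ih =>
      rw [Multiset.map_cons, Multiset.prod_cons, ih, AddMonoidAlgebra.single_mul_single, mul_one,
        Multiset.map_cons, Multiset.singleton_add]
  have h2 := dmulLinear_prod_sum hf x (Multiset.replicate r none + N.map some)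
    (fun j => A.filter fun b => p b = j) u 0
  simp only [Multiset.map_add, Multiset.map_replicate, Multiset.prod_add, Multiset.prod_replicate,
    Multiset.map_map, Function.comp_def, zero_add] at h2
  rw [← AddMonoidAlgebra.one_def, one_mul] at h2
  rw [map_smul, h2, map_sum] at h
  rw [← h]
  refine Finset.sum_congr rfl fun D _ => ?_
  rw [map_smul, h1, dmulLinear_single, one_smul]

end Expansion

/-! ### Coefficients attached to a fixed subtree -/

section CutCoefficients

variable {m : ℕ}

/-- The factor `γ(τ, ϑ, ω) ∏_{δ ∈ ω} φ(δ)` of a triple `(τ, ϑ, ω)`. -/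
noncomputable def cutWeight (φ : NTree m → ℝ) (x : NTree m × Cut m) : ℝ :=
  (x.1.gamma x.2 : ℝ) * (x.2.2.map φ).prod

/-- The coefficient of `φ_y(ϑ)` in `(φ_x ∘ φ_y)(τ)`. -/
noncomputable def cutCoeff (φ : NTree m → ℝ) (τ : NTree m) (ϑ : T m) : ℝ :=
  ∑ p ∈ τ.STset with p.1 = ϑ, cutWeight φ (τ, p)

theorem prod_cutWeight (φ : NTree m → ℝ) (D : Multiset (NTree m × Cut m)) :
    (D.map (cutWeight φ)).prod = (D.map fun x => (x.1.gamma x.2 : ℝ)).prod *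
      ((D.map fun x : NTree m × Cut m => x.2.2).sum.map φ).prod := by
  induction D using Multiset.induction with
  | empty => simp
  | cons x D ih =>
    simp only [Multiset.map_cons, Multiset.prod_cons, Multiset.sum_cons, Multiset.map_add,
      Multiset.prod_add, ih, cutWeight]
    ring

theorem cutCoeff_none (φ : NTree m → ℝ) (τ : NTree m) : cutCoeff φ τ none = φ τ := by
  have h : (τ.STset.filter fun p => p.1 = none) = {(none, {τ})} := by
    ext p
    rw [NTree.STset_eq, Finset.mem_filter, Finset.mem_insert, Finset.mem_image,
      Finset.mem_singleton]
    constructor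
    · rintro ⟨h | ⟨D, -, rfl⟩, h'⟩
      · exact h
      · simp [assemble] at h'
    · rintro rfl
      exact ⟨Or.inl rfl, rfl⟩
  rw [cutCoeff, h, Finset.sum_singleton, cutWeight, NTree.gamma_none]
  simp

theorem cutCoeff_some (φ : NTree m → ℝ) (τ ϑ : NTree m) :
    cutCoeff φ τ (some ϑ) = if τ.root = ϑ.root then
      ∑ D ∈ τ.decs with D.filterMap (fun x => x.2.1) = ϑ.children,
        (symFactor τ.children : ℝ) / (symFactor D : ℝ) * (D.map (cutWeight φ)).prod else 0 := by
  have h := NTree.sum_STset τ fun p => if p.1 = some ϑ then (p.2.map φ).prod else 0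
  simp only [smul_eq_mul, mul_ite, mul_zero, reduceCtorEq, if_false, zero_add] at h
  rw [← Finset.sum_filter] at h
  have h1 : ∀ D : Multiset (NTree m × Cut m), (assemble τ.root D).1 = some ϑ ↔
      τ.root = ϑ.root ∧ D.filterMap (fun x => x.2.1) = ϑ.children := by
    intro D
    rw [assemble, Option.some_inj]
    constructor
    · rintro rfl
      simp
    · rintro ⟨h1, h2⟩
      rw [h1, h2, NTree.node_root_children]
  refine h.trans ?_
  split_ifs with hr
  · rw [Finset.sum_filter]
    refine Finset.sum_congr rfl fun D _ => ?_
    rw [prod_cutWeight, ← mul_assoc]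
    exact if_congr ((h1 D).trans (and_iff_right hr)) rfl rfl
  · refine Finset.sum_eq_zero fun D _ => ?_
    rw [if_neg fun h => hr ((h1 D).1 h).1]

end CutCoefficients
-- Substituting a truncated B-series into an elementary differential
section Substitution

open Filter Topology Asymptotics

variable {d m : ℕ}

/-- The nonempty trees with at most `N` vertices. -/
noncomputable def smallTrees (m N : ℕ) : Finset (NTree m) := (NTree.finite_size_le N).toFinset

theorem mem_smallTrees {N : ℕ} {τ : NTree m} : τ ∈ smallTrees m N ↔ τ.size ≤ N := by
  simp [smallTrees]

/-- The triples `(τ, ϑ, ω)` with `(ϑ, ω) ∈ ST(τ)` for nonempty `τ` with at most `N` vertices. -/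
noncomputable def smallCuts (m N : ℕ) : Finset (NTree m × Cut m) :=
  (smallTrees m N ×ˢ (smallTrees m N).biUnion NTree.STset).filter fun x => x.2 ∈ x.1.STset

theorem mem_smallCuts {N : ℕ} {x : NTree m × Cut m} :
    x ∈ smallCuts m N ↔ x.1 ∈ smallTrees m N ∧ x.2 ∈ x.1.STset := by
  simp only [smallCuts, Finset.mem_filter, Finset.mem_product, Finset.mem_biUnion]
  exact ⟨fun h => ⟨h.1.1, h.2⟩, fun h => ⟨⟨h.1, x.1, h.1, h.2⟩, h.2⟩⟩

theorem NTree.alpha_mul_symFactor (τ : NTree m) :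
    (τ.alpha : ℝ) * symFactor τ.children = (τ.children.map fun t => (t.alpha : ℝ)).prod := by
  have h0 : (symFactor τ.children : ℝ) ≠ 0 := by exact_mod_cast symFactor_ne_zero τ.children
  have := map_multiset_prod (Rat.castHom ℝ) (τ.children.map NTree.alpha)
  rw [Multiset.map_map] at this
  rw [NTree.alpha_eq]
  simp only [Rat.coe_castHom] at this
  rw [Rat.cast_mul, this]
  push_cast
  field_simp
  rfl

theorem prod_pow_size (t : ℝ) (M : Multiset (NTree m)) :
    (M.map fun τ => t ^ τ.size).prod = t ^ (M.map NTree.size).sum := by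
  induction M using Multiset.induction with
  | empty => simp
  | cons x D ih => simp [pow_add, ih]

section

variable (g : Fin (m + 1) → EuclideanSpace ℝ (Fin d) → EuclideanSpace ℝ (Fin d))
  (x₀ : EuclideanSpace ℝ (Fin d)) (φ : NTree m → ℝ)

/-- The contribution of a triple `(τ, ϑ, ω)` to the expansion of `F(ϑ)`. -/
noncomputable def cutTerm (t : ℝ) (x : NTree m × Cut m) : EuclideanSpace ℝ (Fin d) :=
  ((x.1.alpha : ℝ) * cutWeight φ x * t ^ x.1.size) • NTree.F g x.1 x₀

/-- The expansion of `α(ϑ) t^|ϑ| F(ϑ)` at a B-series up to degree `N`. -/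
noncomputable def cutSeries (N : ℕ) (t : ℝ) (ϑ : T m) : EuclideanSpace ℝ (Fin d) :=
  ∑ x ∈ smallCuts m N with x.2.1 = ϑ, cutTerm g x₀ φ t x

theorem cutSeries_eq (N : ℕ) (t : ℝ) (ϑ : T m) :
    cutSeries g x₀ φ N t ϑ = ∑ τ ∈ smallTrees m N,
      t ^ τ.size • ((τ.alpha : ℝ) * cutCoeff φ τ ϑ) • NTree.F g τ x₀ := by
  rw [cutSeries, Finset.sum_finset_product _ (smallTrees m N)
    (fun τ => τ.STset.filter fun p => p.1 = ϑ)]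
  · refine Finset.sum_congr rfl fun τ _ => ?_
    rw [cutCoeff, Finset.mul_sum, Finset.sum_smul, Finset.smul_sum]
    refine Finset.sum_congr rfl fun p _ => ?_
    rw [cutTerm, smul_smul, mul_comm (t ^ _)]
  · intro x
    rw [Finset.mem_filter, mem_smallCuts, Finset.mem_filter, and_assoc]

/-- The contribution of a decomposition into cuts of branches. -/
noncomputable def decTerm (l : Fin (m + 1)) (t : ℝ) (D : Multiset (NTree m × Cut m)) :
    EuclideanSpace ℝ (Fin d) :=
  t ^ (NTree.node l (D.map Prod.fst)).size • ((symFactor D : ℝ)⁻¹ *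
    (D.map fun x => (x.1.alpha : ℝ) * cutWeight φ x).prod) •
      NTree.F g (NTree.node l (D.map Prod.fst)) x₀

end

variable {g : Fin (m + 1) → EuclideanSpace ℝ (Fin d) → EuclideanSpace ℝ (Fin d)}
  {x₀ : EuclideanSpace ℝ (Fin d)} {φ : NTree m → ℝ}

theorem smul_dmul_cutTerm (hg : ∀ l, ContDiff ℝ ((⊤ : ℕ∞) : WithTop ℕ∞) (g l)) (l : Fin (m + 1))
    (t : ℝ) (D : Multiset (NTree m × Cut m)) :
    t • ((symFactor D : ℝ)⁻¹) • dmul (g l) (D.map (cutTerm g x₀ φ t)) x₀ =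
      decTerm g x₀ φ l t D := by
  have h := dmul_smul_map (hg l) (fun x : NTree m × Cut m =>
    (x.1.alpha : ℝ) * cutWeight φ x * t ^ x.1.size) (fun x => NTree.F g x.1 x₀) D 0 x₀
  rw [zero_add, zero_add] at h
  have h2 : D.map (cutTerm g x₀ φ t) = D.map fun x : NTree m × Cut m =>
    ((x.1.alpha : ℝ) * cutWeight φ x * t ^ x.1.size) • NTree.F g x.1 x₀ := rfl
  have h3 : t * (D.map fun x : NTree m × Cut m => t ^ x.1.size).prod =
      t ^ (NTree.node l (D.map Prod.fst)).size := by
    rw [NTree.size_eq, NTree.children_node, pow_add, pow_one, ← prod_pow_size, Multiset.map_map]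
    rfl
  rw [decTerm, ← h3, h2, h, NTree.F_eq hg, NTree.children_node, NTree.root_node, Multiset.map_map,
    Multiset.prod_map_mul, smul_smul, smul_smul, smul_smul]
  congr 1
  ring

/-- The numerator of γ cancels the symmetry factor in α(τ), so a term depends on the decomposition
`D` alone and the sum over τ can be absorbed. Here r counts the branches removed whole. -/
theorem cutSeries_some (N : ℕ) (t : ℝ) (ϑ : NTree m) :
    cutSeries g x₀ φ N t (some ϑ) = ∑ r ∈ Finset.range (N + 1),
      ∑ D ∈ (multisetsOf (smallCuts m N) (ϑ.children.card + r)).filter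
          (fun D => D.filterMap (fun x => x.2.1) = ϑ.children) with
        (NTree.node ϑ.root (D.map Prod.fst)).size ≤ N, decTerm g x₀ φ ϑ.root t D := by
  have h1 : ∀ τ ∈ smallTrees m N, t ^ τ.size • ((τ.alpha : ℝ) * cutCoeff φ τ (some ϑ)) •
      NTree.F g τ x₀ = ∑ D ∈ τ.decs with
        τ.root = ϑ.root ∧ D.filterMap (fun x => x.2.1) = ϑ.children, decTerm g x₀ φ ϑ.root t D := by
    intro τ _
    rw [cutCoeff_some]
    split_ifs with hr
    · rw [Finset.mul_sum, Finset.sum_smul, Finset.smul_sum]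
      simp only [hr, true_and]
      refine Finset.sum_congr rfl fun D hD => ?_
      obtain ⟨hD1, -⟩ := NTree.mem_decs.1 (Finset.mem_filter.1 hD).1
      rw [decTerm, hD1, ← hr, NTree.node_root_children, Multiset.prod_map_mul]
      congr 2
      have := τ.alpha_mul_symFactor
      rw [← hD1, Multiset.map_map, hD1] at this
      simp only [Function.comp_def] at this
      rw [← this]
      ring
    · simp only [hr, false_and, Finset.filter_false, Finset.sum_empty, mul_zero, zero_smul,
        smul_zero]
  rw [cutSeries_eq, Finset.sum_congr rfl h1, Finset.sum_sigma', Finset.sum_sigma']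
  -- `D` determines both indices: its first components are the branches of τ, and its cardinality
  -- exceeds that of the branches of ϑ by r. The bound r ≤ N follows from |D| < |τ| ≤ N.
  refine Finset.sum_nbij' (fun q => ⟨q.2.card - ϑ.children.card, q.2⟩)
    (fun q => ⟨NTree.node ϑ.root (q.2.map Prod.fst), q.2⟩) ?_ ?_ ?_ ?_ ?_
  · rintro ⟨τ, D⟩ h
    simp only [Finset.mem_sigma, Finset.mem_filter, mem_multisetsOf, Finset.mem_range,
      mem_smallTrees, NTree.mem_decs] at h ⊢
    obtain ⟨hτ, ⟨hD1, hD2⟩, hr, hf⟩ := h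
    have hn : NTree.node ϑ.root (D.map Prod.fst) = τ := by
      rw [hD1, ← hr, NTree.node_root_children]
    have hc : ϑ.children.card ≤ D.card := by
      rw [← hf]
      induction D using Quotient.inductionOn with
      | h L => exact List.length_filterMap_le _ L
    have hs : D.card < τ.size := by
      have h2 : (τ.children.map fun _ => 1).sum ≤ (τ.children.map NTree.size).sum :=
        Multiset.sum_map_le_sum_map _ _ fun t _ => t.size_pos
      have h3 := congrArg Multiset.card hD1
      simp only [Multiset.map_const', Multiset.sum_replicate, smul_eq_mul, mul_one,
        Multiset.card_map] at h2 h3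
      rw [NTree.size_eq]
      omega
    refine ⟨by omega, ⟨⟨by omega, fun x hx => mem_smallCuts.2 ⟨mem_smallTrees.2 ?_, hD2 x hx⟩⟩, hf⟩,
      by rw [hn]; exact hτ⟩
    have hm : x.1 ∈ τ.children := by rw [← hD1]; exact Multiset.mem_map_of_mem _ hx
    exact (NTree.size_lt_of_mem hm).le.trans hτ
  · rintro ⟨r, D⟩ h
    simp only [Finset.mem_sigma, Finset.mem_filter, mem_multisetsOf, Finset.mem_range,
      mem_smallTrees, NTree.mem_decs] at h ⊢
    obtain ⟨hr, ⟨⟨hc, hA⟩, hf⟩, hs⟩ := h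
    exact ⟨hs, ⟨by simp, fun x hx => (mem_smallCuts.1 (hA x hx)).2⟩, by simp, hf⟩
  · rintro ⟨τ, D⟩ h
    simp only [Finset.mem_sigma, Finset.mem_filter, NTree.mem_decs] at h
    obtain ⟨hτ, ⟨hD1, hD2⟩, hr, hf⟩ := h
    simp only [hD1, ← hr, NTree.node_root_children]
  · rintro ⟨r, D⟩ h
    simp only [Finset.mem_sigma, Finset.mem_filter, mem_multisetsOf] at h
    obtain ⟨hr, ⟨⟨hc, hA⟩, hf⟩, hs⟩ := h
    simp only [hc, Nat.add_sub_cancel_left]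
  · rintro ⟨τ, D⟩ _
    rfl

/-- The analytic core of the composition rule. The errors are the Taylor remainder (`h1`), the
replacement of branch values by their cut expansions (`h2`, by induction), and terms of degree above
N (`h3`). -/
theorem isBigO_cutSeries_sub (hg : ∀ l, ContDiff ℝ ((⊤ : ℕ∞) : WithTop ℕ∞) (g l)) (N : ℕ)
    (ϑ : NTree m) :
    (fun t : ℝ => ((ϑ.alpha : ℝ) * t ^ ϑ.size) • NTree.F g ϑ (x₀ + cutSeries g x₀ φ N t none) -
      cutSeries g x₀ φ N t (some ϑ)) =O[𝓝 0] fun t => t ^ (N + 1) := by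
  induction ϑ using NTree.induction with
  | h ϑ ih =>
    set l := ϑ.root with hl
    set Q := ϑ.children with hQ
    have hcont : ∀ ϑ : T m, Continuous fun t => cutSeries g x₀ φ N t ϑ := by
      intro ϑ
      simp only [cutSeries_eq]
      fun_prop
    let U : NTree m → ℝ → EuclideanSpace ℝ (Fin d) := fun q t =>
      ((q.alpha : ℝ) * t ^ q.size) • NTree.F g q (x₀ + cutSeries g x₀ φ N t none)
    let V : NTree m → ℝ → EuclideanSpace ℝ (Fin d) := fun q t => cutSeries g x₀ φ N t (some q)
    let w : ℝ → EuclideanSpace ℝ (Fin d) := fun t => cutSeries g x₀ φ N t none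
    have hU : ∀ q ∈ Q, U q =O[𝓝 0] fun _ => (1 : ℝ) := by
      intro q _
      have h1 := (NTree.contDiff_F hg q).continuous
      have h2 := hcont none
      have : Continuous (U q) := by fun_prop
      exact (this.tendsto 0).isBigO_one ℝ
    have hV : ∀ q ∈ Q, V q =O[𝓝 0] fun _ => (1 : ℝ) := fun q _ =>
      ((hcont (some q)).tendsto 0).isBigO_one ℝ
    have hw : w =O[𝓝 0] fun t => t := by
      simp only [w, cutSeries_eq]
      refine IsBigO.fun_sum fun τ _ => ?_
      have h1 := (isBigO_pow_of_le (Nat.succ_le_of_lt τ.size_pos)).smul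
        (isBigO_const_const (((τ.alpha : ℝ) * cutCoeff φ τ none) • NTree.F g τ x₀)
          (one_ne_zero (α := ℝ)) (𝓝 (0 : ℝ)))
      simpa using h1
    have hw1 : w =O[𝓝 0] fun _ => (1 : ℝ) := ((hcont none).tendsto 0).isBigO_one ℝ
    have h1 := isBigO_dmul_sub_taylor (hg l) U Q hU x₀ w hw N
    have h2 : (fun t => ∑ r ∈ Finset.range (N + 1), ((r.factorial : ℝ)⁻¹) •
        (dmul (g l) (Multiset.replicate r (w t) + Q.map fun q => U q t) x₀ -
          dmul (g l) (Multiset.replicate r (w t) + Q.map fun q => V q t) x₀)) =O[𝓝 0]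
        fun t => t ^ (N + 1) := by
      refine IsBigO.fun_sum fun r _ => ?_
      have := isBigO_dmul_sub_dmul (hg l) U V Q (N + 1) x₀ hU hV ih (Multiset.replicate r w)
        fun u hu => by rw [Multiset.eq_of_mem_replicate hu]; exact hw1
      simp only [Multiset.map_replicate] at this
      exact this.const_smul_left ((r.factorial : ℝ)⁻¹)
    have h3 : (fun t => ∑ r ∈ Finset.range (N + 1),
        ∑ D ∈ (multisetsOf (smallCuts m N) (Q.card + r)).filter
          (fun D => D.filterMap (fun x => x.2.1) = Q) with
        ¬ (NTree.node l (D.map Prod.fst)).size ≤ N, decTerm g x₀ φ l t D) =O[𝓝 0]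
          fun t => t ^ (N + 1) := by
      refine IsBigO.fun_sum fun r _ => IsBigO.fun_sum fun D hD => ?_
      have h1 := (isBigO_pow_of_le (Nat.succ_le_of_lt
        (not_le.1 (Finset.mem_filter.1 hD).2))).smul
        (isBigO_const_const (((symFactor D : ℝ)⁻¹ *
          (D.map fun x => (x.1.alpha : ℝ) * cutWeight φ x).prod) •
            NTree.F g (NTree.node l (D.map Prod.fst)) x₀)
          (one_ne_zero (α := ℝ)) (𝓝 (0 : ℝ)))
      simp only [smul_eq_mul, mul_one] at h1
      exact h1
    have h4 : (fun t : ℝ => (t * (symFactor Q : ℝ)⁻¹)) =O[𝓝 0] fun _ => (1 : ℝ) :=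
      ((by fun_prop : Continuous fun t : ℝ => t * (symFactor Q : ℝ)⁻¹).tendsto 0).isBigO_one ℝ
    have h5 := (h4.smul (h1.add h2)).congr_right (g₂ := fun t => t ^ (N + 1)) fun t => by simp
    refine (h5.add h3).congr_left fun t => ?_
    have h6 : ((ϑ.alpha : ℝ) * t ^ ϑ.size) • NTree.F g ϑ (x₀ + w t) =
        (t * (symFactor Q : ℝ)⁻¹) • dmul (g l) (Q.map fun q => U q t) (x₀ + w t) := by
      have := dmul_smul_map (hg l) (fun q : NTree m => (q.alpha : ℝ) * t ^ q.size)
        (fun q => NTree.F g q (x₀ + w t)) Q 0 (x₀ + w t)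
      rw [zero_add, zero_add] at this
      rw [NTree.F_eq hg, this, smul_smul, Multiset.prod_map_mul, ← NTree.alpha_mul_symFactor,
        NTree.size_eq, pow_add, pow_one, prod_pow_size]
      congr 1
      have h0 : (symFactor Q : ℝ) ≠ 0 := by exact_mod_cast symFactor_ne_zero Q
      rw [hQ] at h0 ⊢
      field_simp
    have h7 : cutSeries g x₀ φ N t (some ϑ) + ∑ r ∈ Finset.range (N + 1),
        ∑ D ∈ (multisetsOf (smallCuts m N) (Q.card + r)).filter
          (fun D => D.filterMap (fun x => x.2.1) = Q) with
        ¬ (NTree.node l (D.map Prod.fst)).size ≤ N, decTerm g x₀ φ l t D =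
        (t * (symFactor Q : ℝ)⁻¹) • ∑ r ∈ Finset.range (N + 1), ((r.factorial : ℝ)⁻¹) •
          dmul (g l) (Multiset.replicate r (w t) + Q.map fun q => V q t) x₀ := by
      rw [cutSeries_some, ← Finset.sum_add_distrib, Finset.smul_sum]
      refine Finset.sum_congr rfl fun r _ => ?_
      rw [Finset.sum_filter_add_sum_filter_not, smul_smul, mul_assoc, mul_smul,
        mul_comm (symFactor Q : ℝ)⁻¹]
      -- The label `none` collects the cuts with empty subtree, whose terms sum to w(t); the label q
      -- collects those with subtree q, whose terms sum to `V q t`.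
      have := dmul_sum_expand (hg l) (smallCuts m N) (fun x => x.2.1) (cutTerm g x₀ φ t) x₀ Q r
      refine Eq.trans ?_ (congrArg (fun v => t • v) this.symm)
      rw [Finset.smul_sum]
      exact Finset.sum_congr rfl fun D _ => (smul_dmul_cutTerm hg l t D).symm
    rw [h6, eq_sub_of_add_eq h7]
    simp only [smul_sub, Finset.sum_sub_distrib, smul_add]
    abel

end Substitution
-- Composition of formal B-series
section FormalComposition

open Filter Topology Asymptotics

theorem sum_eq_sum_of_isBigO {E : Type*} [NormedAddCommGroup E] [NormedSpace ℝ E] {ι ι' : Type*}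
    (s : Finset ι) (s' : Finset ι') (e : ι → ℕ) (e' : ι' → ℕ) (a : ι → E) (a' : ι' → E) (N : ℕ)
    (h : (fun t : ℝ => ∑ i ∈ s, t ^ e i • a i - ∑ i ∈ s', t ^ e' i • a' i) =O[𝓝 0]
      fun t => t ^ (N + 1)) (n : ℕ) (hn : n ≤ N) :
    ∑ i ∈ s with e i = n, a i = ∑ i ∈ s' with e' i = n, a' i := by
  have := sum_eq_zero_of_isBigO (s.disjSum s') (Sum.elim e e') (Sum.elim a fun i => -a' i) N
    (by simpa [Finset.sum_disjSum, sub_eq_add_neg] using h) n hn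
  rw [Finset.sum_filter, Finset.sum_disjSum] at this
  have h2 : (∑ i ∈ s, if e i = n then a i else 0) +
      ∑ i ∈ s', (if e' i = n then -a' i else 0) = 0 := this
  rw [← Finset.sum_filter, ← Finset.sum_filter, Finset.sum_neg_distrib] at h2
  exact eq_of_sub_eq_zero (by rw [sub_eq_add_neg, h2])

variable {d m : ℕ}

theorem sum_treesOfSize {E : Type*} [AddCommMonoid E] {n N : ℕ} (hn : n ≤ N) (f : T m → E) :
    ∑ τ ∈ treesOfSize m n, f τ = (if n = 0 then f none else 0) +
      ∑ τ ∈ smallTrees m N with τ.size = n, f (some τ) := by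
  have h : treesOfSize m n = (if n = 0 then {none} else ∅) ∪
      ((smallTrees m N).filter fun τ => τ.size = n).map Function.Embedding.some := by
    ext τ
    simp only [treesOfSize, Set.Finite.mem_toFinset, Finset.mem_union, Finset.mem_map,
      Finset.mem_filter, mem_smallTrees, Function.Embedding.some_apply, Set.mem_ofPred_eq]
    cases τ with
    | none =>
      split_ifs with h
      · simp [size, h]
      · simp [size, Ne.symm h]
    | some τ =>
      split_ifs with h
      · simp [size, h, τ.size_pos.ne']
      · simp only [size, Finset.notMem_empty, Option.some.injEq, exists_eq_right, false_or]
        exact ⟨fun h => ⟨by omega, h⟩, fun h => h.2⟩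
  rw [h, Finset.sum_union, Finset.sum_map]
  · congr 1
    split_ifs <;> simp
  · rw [Finset.disjoint_left]
    intro τ h1 h2
    obtain ⟨τ', -, rfl⟩ := Finset.mem_map.1 h2
    split_ifs at h1 <;> simp at h1

/-- Tuples of length at most `N` with entries in `s`. -/
def tuplesOf {ι : Type*} [DecidableEq ι] (N : ℕ) (s : Finset ι) : Finset (Σ r : ℕ, Fin r → ι) :=
  (Finset.range (N + 1)).sigma fun _ => Fintype.piFinset fun _ => s

theorem mem_tuplesOf {ι : Type*} [DecidableEq ι] {N : ℕ} {s : Finset ι}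
    {q : Σ r : ℕ, Fin r → ι} : q ∈ tuplesOf N s ↔ q.1 ≤ N ∧ ∀ i, q.2 i ∈ s := by
  simp [tuplesOf]

theorem formalSubst_eq_sum_tuples (f : EuclideanSpace ℝ (Fin d) → EuclideanSpace ℝ (Fin d))
    (Y : FormalSeries d) {n N : ℕ} (hn : n ≤ N) :
    formalSubst f Y n = ∑ q ∈ tuplesOf N (Finset.Icc 1 N) with ∑ j, q.2 j = n,
      ((q.1.factorial : ℝ)⁻¹) • iteratedFDeriv ℝ q.1 f (Y 0) fun j => Y (q.2 j) := by
  refine Finset.sum_bij (fun c _ => ⟨c.length, c.blocksFun⟩) ?_ ?_ ?_ ?_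
  · intro c _
    refine Finset.mem_filter.2 ⟨mem_tuplesOf.2 ⟨c.length_le.trans hn, fun i => ?_⟩,
      c.sum_blocksFun⟩
    exact Finset.mem_Icc.2 ⟨c.one_le_blocksFun i, (c.blocksFun_le i).trans hn⟩
  · intro c _ c' _ h
    refine Composition.ext ?_
    rw [← Composition.ofFn_blocksFun, ← Composition.ofFn_blocksFun]
    exact congrArg (fun q : Σ r : ℕ, Fin r → ℕ => List.ofFn q.2) h
  · rintro ⟨r, v⟩ h
    obtain ⟨h1, h2⟩ := Finset.mem_filter.1 h
    have h3 := (mem_tuplesOf.1 h1).2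
    refine ⟨⟨List.ofFn v, fun {i} hi => ?_, ?_⟩, Finset.mem_univ _, ?_⟩
    · obtain ⟨j, rfl⟩ := (List.mem_ofFn' v i).1 hi
      exact (Finset.mem_Icc.1 (h3 j)).1
    · rw [List.sum_ofFn]
      exact h2
    · refine (List.equivSigmaTuple (α := ℕ)).symm.injective ?_
      exact Composition.ofFn_blocksFun _
  · intro c _
    rfl

variable {g : Fin (m + 1) → EuclideanSpace ℝ (Fin d) → EuclideanSpace ℝ (Fin d)}
  {x₀ : EuclideanSpace ℝ (Fin d)} {φ : T m → ℝ}

theorem bSeries_zero (hφ : φ none = 1) : bSeries g φ x₀ 0 = x₀ := by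
  rw [bSeries, sum_treesOfSize (le_refl 0), if_pos rfl, Finset.sum_eq_zero]
  · simp [alpha, F, hφ]
  · intro τ hτ
    exact absurd (Finset.mem_filter.1 hτ).2 τ.size_pos.ne'

theorem cutSeries_none_eq (N : ℕ) (t : ℝ) :
    cutSeries g x₀ (fun τ => φ (some τ)) N t none = ∑ τ ∈ smallTrees m N,
      t ^ τ.size • ((τ.alpha : ℝ) * φ (some τ)) • NTree.F g τ x₀ := by
  rw [cutSeries_eq]
  simp only [cutCoeff_none]

theorem cutSeries_none_eq_bSeries (N : ℕ) (t : ℝ) :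
    cutSeries g x₀ (fun τ => φ (some τ)) N t none =
      ∑ j ∈ Finset.Icc 1 N, t ^ j • bSeries g φ x₀ j := by
  rw [cutSeries_none_eq, ← Finset.sum_fiberwise_of_maps_to (t := Finset.Icc 1 N)
    (g := NTree.size) fun τ hτ => Finset.mem_Icc.2 ⟨τ.size_pos, mem_smallTrees.1 hτ⟩]
  refine Finset.sum_congr rfl fun j hj => ?_
  obtain ⟨h1, h2⟩ := Finset.mem_Icc.1 hj
  rw [bSeries, sum_treesOfSize h2, if_neg (by omega), zero_add, Finset.smul_sum]
  refine Finset.sum_congr rfl fun τ hτ => ?_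
  rw [(Finset.mem_filter.1 hτ).2]
  rfl

/-- Both sides are coefficients of the same function f(x₀ + w(t)), with w expanded by degree or by
trees. The form by trees matches the terms of the convergent composed series. -/
theorem formalSubst_bSeries_eq_sum_trees
    {f : EuclideanSpace ℝ (Fin d) → EuclideanSpace ℝ (Fin d)}
    (hf : ContDiff ℝ ((⊤ : ℕ∞) : WithTop ℕ∞) f) (hφ : φ none = 1) {n N : ℕ} (hn : n ≤ N) :
    formalSubst f (bSeries g φ x₀) n =
      ∑ q ∈ tuplesOf N (smallTrees m N) with ∑ j, (q.2 j).size = n,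
        ((q.1.factorial : ℝ)⁻¹) • iteratedFDeriv ℝ q.1 f x₀
          fun j => (((q.2 j).alpha : ℝ) * φ (some (q.2 j))) • NTree.F g (q.2 j) x₀ := by
  rw [formalSubst_eq_sum_tuples f _ hn, bSeries_zero hφ]
  refine sum_eq_sum_of_isBigO _ _ _ _ _ _ N ?_ n hn
  have h1 := isBigO_sub_taylor_sum hf (smallTrees m N) NTree.size (fun τ _ => τ.size_pos)
    (fun τ => ((τ.alpha : ℝ) * φ (some τ)) • NTree.F g τ x₀) x₀ N
  have h2 := isBigO_sub_taylor_sum hf (Finset.Icc 1 N) id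
    (fun j hj => (Finset.mem_Icc.1 hj).1) (bSeries g φ x₀) x₀ N
  refine (h1.sub h2).congr_left fun t => ?_
  rw [← cutSeries_none_eq, cutSeries_none_eq_bSeries]
  simp only [id, sub_sub_sub_cancel_left, tuplesOf]

/-- Both sides are the coefficient of degree |ϑ| + n of α(ϑ) t^|ϑ| F(ϑ)(x₀ + w(t)): by Taylor
expansion on the left, by `isBigO_cutSeries_sub` on the right. -/
theorem alpha_smul_formalSubst (hg : ∀ l, ContDiff ℝ ((⊤ : ℕ∞) : WithTop ℕ∞) (g l))
    (hφ : φ none = 1) (ϑ : NTree m) (n : ℕ) :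
    (ϑ.alpha : ℝ) • formalSubst (NTree.F g ϑ) (bSeries g φ x₀) n =
      ∑ τ ∈ smallTrees m (ϑ.size + n) with τ.size = ϑ.size + n,
        ((τ.alpha : ℝ) * cutCoeff (fun τ => φ (some τ)) τ (some ϑ)) • NTree.F g τ x₀ := by
  set N := ϑ.size + n with hN
  have h1 := isBigO_sub_taylor_sum (NTree.contDiff_F hg ϑ) (Finset.Icc 1 N) id
    (fun j hj => (Finset.mem_Icc.1 hj).1) (bSeries g φ x₀) x₀ N
  have h2 := isBigO_cutSeries_sub (x₀ := x₀) (φ := fun τ => φ (some τ)) hg N ϑ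
  have h3 : (fun t : ℝ => (ϑ.alpha : ℝ) * t ^ ϑ.size) =O[𝓝 0] fun _ => (1 : ℝ) :=
    ((by fun_prop : Continuous fun t : ℝ => (ϑ.alpha : ℝ) * t ^ ϑ.size).tendsto 0).isBigO_one ℝ
  have h4 := (h3.smul h1).congr_right (g₂ := fun t => t ^ (N + 1)) fun t => by simp
  have h5 := sum_eq_sum_of_isBigO (tuplesOf N (Finset.Icc 1 N)) (smallTrees m N)
    (fun q => ϑ.size + ∑ j, q.2 j) NTree.size
    (fun q => (ϑ.alpha : ℝ) • ((q.1.factorial : ℝ)⁻¹) •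
      iteratedFDeriv ℝ q.1 (NTree.F g ϑ) x₀ fun j => bSeries g φ x₀ (q.2 j))
    (fun τ => ((τ.alpha : ℝ) * cutCoeff (fun τ => φ (some τ)) τ (some ϑ)) • NTree.F g τ x₀)
    N ?_ N le_rfl
  · rw [← h5, formalSubst_eq_sum_tuples _ _ (by omega : n ≤ N), bSeries_zero hφ, Finset.smul_sum]
    refine Finset.sum_congr (Finset.filter_congr fun q _ => ?_) fun _ _ => rfl
    omega
  · refine (h2.sub h4).congr_left fun t => ?_
    rw [cutSeries_none_eq_bSeries, ← cutSeries_eq, smul_sub, Finset.smul_sum]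
    simp only [id, tuplesOf]
    rw [sub_sub_sub_cancel_left]
    congr 1
    refine Finset.sum_congr rfl fun q _ => ?_
    simp only [smul_smul, pow_add]
    congr 1
    ring

/-- The composition `(φ_x ∘ φ_y)(τ)` for weights with real values. -/
noncomputable def rcomp (φx φy : T m → ℝ) (τ : T m) : ℝ :=
  ∑ p ∈ STset τ, (gamma τ p : ℝ) * (φy p.1 * (p.2.map fun δ => φx (some δ)).prod)

/-- Regroups the cuts by subtree in the shape of `bSeriesAt`. A subtree has at most n vertices, so
it is met in exactly one summand of the antidiagonal. -/
theorem rcomp_some (φx φy : T m → ℝ) (τ : NTree m) {n : ℕ} (hn : τ.size = n) :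
    rcomp φx φy (some τ) = ∑ q ∈ Finset.HasAntidiagonal.antidiagonal n,
      ∑ ϑ ∈ treesOfSize m q.1, φy ϑ * cutCoeff (fun τ => φx (some τ)) τ ϑ := by
  have h1 : ∀ ϑ : T m, φy ϑ * cutCoeff (fun τ => φx (some τ)) τ ϑ =
      ∑ p ∈ τ.STset, if p.1 = ϑ then φy p.1 * cutWeight (fun τ => φx (some τ)) (τ, p) else 0 := by
    intro ϑ
    rw [cutCoeff, Finset.mul_sum, ← Finset.sum_filter]
    exact Finset.sum_congr rfl fun p hp => by rw [(Finset.mem_filter.1 hp).2]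
  simp only [h1]
  rw [Finset.sum_sigma', Finset.sum_comm, rcomp]
  refine Finset.sum_congr rfl fun p hp => ?_
  rw [← Finset.sum_sigma' (Finset.HasAntidiagonal.antidiagonal n) (fun q => treesOfSize m q.1)
    (fun _ ϑ => if p.1 = ϑ then φy p.1 * cutWeight (fun τ => φx (some τ)) (τ, p) else 0)]
  simp only [Finset.sum_ite_eq]
  have hs : size p.1 ≤ n := hn ▸ τ.size_le_of_mem_STset p hp
  rw [Finset.sum_eq_single_of_mem (size p.1, n - size p.1)
    (Finset.HasAntidiagonal.mem_antidiagonal.2 (by omega)), if_pos]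
  · rw [cutWeight]
    change (τ.gamma p : ℝ) * _ = _
    ring
  · simp [treesOfSize]
  · rintro q hq hne
    rw [if_neg]
    simp only [treesOfSize, Set.Finite.mem_toFinset, Set.mem_ofPred_eq]
    intro h
    apply hne
    rw [Finset.HasAntidiagonal.mem_antidiagonal] at hq
    exact Prod.ext h.symm (by simp only; omega)

/-- The B-series of a B-series is the B-series of the composed weights. -/
theorem bSeriesAt_bSeries (hg : ∀ l, ContDiff ℝ ((⊤ : ℕ∞) : WithTop ℕ∞) (g l))
    {φx φy : T m → ℝ} (hx : φx none = 1) (hy : φy none = 0) :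
    bSeriesAt g φy (bSeries g φx x₀) = bSeries g (rcomp φx φy) x₀ := by
  funext n
  have h1 : ∀ q ∈ Finset.HasAntidiagonal.antidiagonal n, ∀ ϑ ∈ treesOfSize m q.1,
      ((alpha ϑ : ℝ) * φy ϑ) • formalSubst (F g ϑ) (bSeries g φx x₀) q.2 =
        ∑ τ ∈ smallTrees m n with τ.size = n, ((τ.alpha : ℝ) *
          (φy ϑ * cutCoeff (fun τ => φx (some τ)) τ ϑ)) • NTree.F g τ x₀ := by
    intro q hq ϑ hϑ
    cases ϑ with
    | none => simp [hy]
    | some ϑ =>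
      simp only [treesOfSize, Set.Finite.mem_toFinset, Set.mem_ofPred_eq, size] at hϑ
      have hn : ϑ.size + q.2 = n := by rw [hϑ]; exact Finset.HasAntidiagonal.mem_antidiagonal.1 hq
      have := alpha_smul_formalSubst (x₀ := x₀) hg hx ϑ q.2
      rw [hn] at this
      change ((ϑ.alpha : ℝ) * φy (some ϑ)) • formalSubst (NTree.F g ϑ) _ q.2 = _
      rw [mul_comm, mul_smul, this, Finset.smul_sum]
      refine Finset.sum_congr rfl fun τ _ => ?_
      rw [smul_smul]
      congr 1
      ring
  rw [bSeriesAt, Finset.sum_congr rfl fun q hq => Finset.sum_congr rfl (h1 q hq), bSeries,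
    sum_treesOfSize (le_refl n)]
  have h2 : (if n = 0 then ((alpha (none : T m) : ℝ) * rcomp φx φy none) • F g none x₀
      else 0) = 0 := by
    simp [rcomp, STset, hy]
  rw [h2, zero_add, Finset.sum_sigma', Finset.sum_comm]
  refine Finset.sum_congr rfl fun τ hτ => ?_
  rw [rcomp_some φx φy τ (Finset.mem_filter.1 hτ).2, ← Finset.sum_smul, Finset.sum_sigma',
    ← Finset.mul_sum]
  rfl

end FormalComposition
-- Convergent B-series
section Convergence

open Filter Topology

/-- A real analytic function is the sum of its Taylor series wherever the series converges absolutely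
along a segment. -/
theorem tsum_taylor_eq {E G : Type*} [NormedAddCommGroup E] [NormedSpace ℝ E]
    [NormedAddCommGroup G] [NormedSpace ℝ G] [CompleteSpace G] {f : E → G}
    (hf : AnalyticOnNhd ℝ f Set.univ) (x w : E)
    (hs : Summable fun r : ℕ => ‖((r.factorial : ℝ)⁻¹) • iteratedFDeriv ℝ r f x fun _ => w‖) :
    ∑' r : ℕ, ((r.factorial : ℝ)⁻¹) • iteratedFDeriv ℝ r f x (fun _ => w) = f (x + w) := by
  set a : ℕ → G := fun r => ((r.factorial : ℝ)⁻¹) • iteratedFDeriv ℝ r f x fun _ => w with ha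
  let u : ℝ → G := fun t => f (x + t • w)
  let P : ℝ → G := fun t => ∑' r, t ^ r • a r
  have hu : AnalyticOnNhd ℝ u Set.univ := fun t _ =>
    (hf (x + t • w) trivial).comp (f := fun t : ℝ => x + t • w) (by fun_prop)
  let p : FormalMultilinearSeries ℝ ℝ G := fun r => ContinuousMultilinearMap.mkPiRing ℝ (Fin r) (a r)
  have hrad : (1 : ENNReal) ≤ p.radius := by
    obtain ⟨C, hC⟩ := hs.tendsto_atTop_zero.bddAbove_range
    refine p.le_radius_of_bound C fun n => ?_
    simp only [p, NNReal.coe_one, one_pow, mul_one, ContinuousMultilinearMap.norm_mkPiRing]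
    exact hC ⟨n, rfl⟩
  have hP : AnalyticOnNhd ℝ P (Metric.ball 0 1) := by
    have h1 := (p.hasFPowerSeriesOnBall (one_pos.trans_le hrad)).analyticOnNhd
    have h2 : p.sum = P := by
      funext t
      simp [FormalMultilinearSeries.sum, p, P]
    rw [h2] at h1
    refine h1.mono fun t ht => ?_
    rw [Metric.mem_ball] at ht
    rw [Metric.mem_eball, edist_dist]
    refine lt_of_lt_of_le ?_ hrad
    rw [← ENNReal.ofReal_one]
    exact (ENNReal.ofReal_lt_ofReal_iff one_pos).2 ht
  have hev : P =ᶠ[𝓝 0] u := by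
    obtain ⟨q, R, hq⟩ := hf x trivial
    have hw : Tendsto (fun t : ℝ => t • w) (𝓝 0) (𝓝 0) := by
      have : Continuous fun t : ℝ => t • w := by fun_prop
      simpa using this.tendsto 0
    filter_upwards [hw.eventually (Metric.eball_mem_nhds 0 hq.r_pos)] with t ht
    change P t = f (x + t • w)
    rw [← (hq.hasSum_iteratedFDeriv ht).tsum_eq]
    refine tsum_congr fun r => ?_
    rw [ContinuousMultilinearMap.map_smul_univ]
    rw [Finset.prod_const, Finset.card_univ, Fintype.card_fin, smul_comm]
  have heq : Set.EqOn P u (Metric.ball 0 1) :=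
    hP.eqOn_of_preconnected_of_eventuallyEq (hu.mono (Set.subset_univ _))
      (convex_ball 0 1).isPreconnected (Metric.mem_ball_self one_pos) hev
  -- The identity theorem reaches only |t| < 1, and t = 1 may be on the boundary of convergence.
  -- Absolute convergence there makes `P` continuous on [0, 1], so the equality passes to the
  -- endpoint.
  have hPc : ContinuousOn P (Set.Icc 0 1) := by
    refine continuousOn_tsum (u := fun r => ‖a r‖) (fun r => by fun_prop) hs fun r t ht => ?_
    rw [norm_smul, norm_pow, Real.norm_eq_abs, abs_of_nonneg ht.1]
    exact mul_le_of_le_one_left (norm_nonneg _) (pow_le_one₀ ht.1 ht.2)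
  have h1 : Set.EqOn P u (Set.Ico 0 1) := fun t ht => heq (by
    rw [Metric.mem_ball, Real.dist_0_eq_abs, abs_of_nonneg ht.1]
    exact ht.2)
  have h2 := h1.of_subset_closure hPc (hu.continuousOn.mono (Set.subset_univ _))
    Set.Ico_subset_Icc_self (by rw [closure_Ico zero_ne_one])
    (Set.right_mem_Icc.2 (zero_le_one (α := ℝ)))
  simpa [P, u] using h2

/-- The boxes s^r are cofinal among finite sets of tuples. Over a box the sum is M at a partial sum
of v, which converges by continuity of M. -/
theorem tsum_multilinear {E G ι : Type*} [NormedAddCommGroup E] [NormedSpace ℝ E]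
    [NormedAddCommGroup G] [NormedSpace ℝ G] {r : ℕ}
    (M : ContinuousMultilinearMap ℝ (fun _ : Fin r => E) G) {v : ι → E} {w : E} (hv : HasSum v w)
    (hs : Summable fun q : Fin r → ι => M fun j => v (q j)) :
    ∑' q : Fin r → ι, M (fun j => v (q j)) = M fun _ => w := by
  classical
  have h1 : Tendsto (fun s : Finset ι => Fintype.piFinset fun _ : Fin r => s) atTop atTop := by
    refine tendsto_atTop_finset_of_monotone (fun s t hst => Fintype.piFinset_subset _ _ fun _ => hst)
      fun q => ⟨Finset.univ.image q, Fintype.mem_piFinset.2 fun j =>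
        Finset.mem_image_of_mem _ (Finset.mem_univ j)⟩
  have h2 := hs.hasSum.comp h1
  have h3 : Tendsto (fun s : Finset ι => M fun _ => ∑ i ∈ s, v i) atTop (𝓝 (M fun _ => w)) :=
    (M.cont.tendsto _).comp (tendsto_pi_nhds.2 fun _ => hv)
  refine tendsto_nhds_unique h2 (h3.congr fun s => ?_)
  rw [ContinuousMultilinearMap.map_sum_finset]
  rfl

theorem tsum_eq_tsum_sum_of_grading {E α : Type*} [NormedAddCommGroup E] [CompleteSpace E]
    {f : α → E}
    (hf : Summable f) (deg : α → ℕ) (A : ℕ → Finset α) (hA : ∀ n p, p ∈ A n ↔ deg p = n) :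
    ∑' p, f p = ∑' n, ∑ p ∈ A n, f p := by
  rw [← (hf.hasSum.tsum_fiberwise deg).tsum_eq]
  refine tsum_congr fun n => ?_
  have : deg ⁻¹' {n} = (A n : Set α) := by
    ext p
    simp [hA]
  rw [this, Finset.tsum_subtype']

theorem summable_of_const_smul {E α : Type*} [NormedAddCommGroup E] [NormedSpace ℝ E] {f : α → E}
    {c : ℝ} (hc : c ≠ 0) (h : Summable fun a => c • f a) : Summable f :=
  (h.const_smul c⁻¹).congr fun a => inv_smul_smul₀ hc (f a)

theorem tsum_option_eq {E α : Type*} [NormedAddCommGroup E] {f : Option α → E} (hf : Summable f) :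
    ∑' p, f p = f none + ∑' a, f (some a) := by
  classical
  rw [hf.tsum_eq_add_tsum_ite none]
  congr 1
  rw [← (Option.some_injective α).tsum_eq]
  · simp
  · intro p hp
    cases p with
    | none => simp at hp
    | some a => exact ⟨a, rfl⟩

variable {d m : ℕ} {g : Fin (m + 1) → EuclideanSpace ℝ (Fin d) → EuclideanSpace ℝ (Fin d)}
  {x₀ : EuclideanSpace ℝ (Fin d)}

theorem analyticOnNhd_F (hg : ∀ l, AnalyticOnNhd ℝ (g l) Set.univ) (ϑ : T m) :
    AnalyticOnNhd ℝ (F g ϑ) Set.univ := by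
  cases ϑ with
  | none => exact analyticOnNhd_id
  | some ϑ => exact NTree.analyticOnNhd_F hg ϑ

theorem contDiff_F (hg : ∀ l, ContDiff ℝ ((⊤ : ℕ∞) : WithTop ℕ∞) (g l)) (ϑ : T m) :
    ContDiff ℝ ((⊤ : ℕ∞) : WithTop ℕ∞) (F g ϑ) := by
  cases ϑ with
  | none => exact contDiff_id
  | some ϑ => exact NTree.contDiff_F hg ϑ

theorem bSum_eq_tsum_bSeries {φ : T m → ℝ} (h : BConverges g φ x₀) :
    bSum g φ x₀ = ∑' n, bSeries g φ x₀ n :=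
  tsum_eq_tsum_sum_of_grading h size (treesOfSize m) fun n p => by simp [treesOfSize]

/-- The terms of the composed series, indexed by a tree and a tuple of trees. -/
noncomputable def compTerm
    (g : Fin (m + 1) → EuclideanSpace ℝ (Fin d) → EuclideanSpace ℝ (Fin d))
    (φx φy : T m → ℝ) (x : EuclideanSpace ℝ (Fin d)) (p : T m × Σ r : ℕ, Fin r → NTree m) :
    EuclideanSpace ℝ (Fin d) :=
  ((alpha p.1 : ℝ) * φy p.1) • ((p.2.1.factorial : ℝ)⁻¹) •
    iteratedFDeriv ℝ p.2.1 (F g p.1) x fun i =>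
      (((p.2.2 i).alpha : ℝ) * φx (some (p.2.2 i))) • NTree.F g (p.2.2 i) x

variable {φx φy : T m → ℝ}

theorem summable_compTerm (h : BCompConverges g φx φy x₀) :
    Summable (compTerm g φx φy x₀) :=
  ((Equiv.refl (T m)).prodCongr (List.equivSigmaTuple (α := NTree m))).summable_iff.1 h

theorem tsum_compTerm_eq_bSum (hg : ∀ l, AnalyticOnNhd ℝ (g l) Set.univ) (hx : φx none = 1)
    (hc : BConverges g φx x₀) (h : BCompConverges g φx φy x₀) :
    ∑' p, compTerm g φx φy x₀ p = bSum g φy (bSum g φx x₀) := by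
  have hs := summable_compTerm h
  rw [hs.tsum_prod, bSum]
  refine tsum_congr fun ϑ => ?_
  -- If the coefficient vanishes, the hypothesis says nothing about the Taylor series of F(ϑ), but
  -- both sides are 0. Otherwise the coefficient can be divided out.
  by_cases hc0 : (alpha ϑ : ℝ) * φy ϑ = 0
  · simp [compTerm, hc0]
  have hs1 : Summable fun q : Σ r : ℕ, Fin r → NTree m => ((q.1.factorial : ℝ)⁻¹) •
      iteratedFDeriv ℝ q.1 (F g ϑ) x₀ fun i =>
        (((q.2 i).alpha : ℝ) * φx (some (q.2 i))) • NTree.F g (q.2 i) x₀ := by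
    have h0 := hs.prod_factor ϑ
    simp only [compTerm] at h0
    exact summable_of_const_smul hc0 h0
  have hw : HasSum (fun τ : NTree m => ((τ.alpha : ℝ) * φx (some τ)) • NTree.F g τ x₀)
      (bSum g φx x₀ - x₀) := by
    have h1 : Summable fun τ : NTree m => ((τ.alpha : ℝ) * φx (some τ)) • NTree.F g τ x₀ := by
      have h0 := Summable.comp_injective hc (Option.some_injective (NTree m))
      exact h0
    have h2 := tsum_option_eq hc
    have h3 : bSum g φx x₀ - x₀ =
        ∑' τ : NTree m, ((τ.alpha : ℝ) * φx (some τ)) • NTree.F g τ x₀ := by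
      rw [bSum, h2]
      simp [alpha, hx, F]
    rw [h3]
    exact h1.hasSum
  have h4 : ∀ r : ℕ, ∑' q : Fin r → NTree m, ((r.factorial : ℝ)⁻¹) •
      iteratedFDeriv ℝ r (F g ϑ) x₀ (fun i =>
        (((q i).alpha : ℝ) * φx (some (q i))) • NTree.F g (q i) x₀) =
      ((r.factorial : ℝ)⁻¹) • iteratedFDeriv ℝ r (F g ϑ) x₀ fun _ => bSum g φx x₀ - x₀ := by
    intro r
    have h5 := hs1.sigma_factor r
    have h6 : (r.factorial : ℝ)⁻¹ ≠ 0 := inv_ne_zero (by exact_mod_cast r.factorial_ne_zero)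
    have h7 : Summable fun q : Fin r → NTree m => iteratedFDeriv ℝ r (F g ϑ) x₀ fun i =>
        (((q i).alpha : ℝ) * φx (some (q i))) • NTree.F g (q i) x₀ :=
      summable_of_const_smul h6 h5
    have h8 := tsum_multilinear (iteratedFDeriv ℝ r (F g ϑ) x₀)
      (v := fun τ : NTree m => ((τ.alpha : ℝ) * φx (some τ)) • NTree.F g τ x₀) hw h7
    rw [h7.tsum_const_smul, h8]
  simp only [compTerm]
  rw [hs1.tsum_const_smul, hs1.tsum_sigma]
  simp only [h4]
  rw [tsum_taylor_eq (analyticOnNhd_F hg ϑ), add_sub_cancel]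
  have h8 := hs1.sigma
  simp only [h4] at h8
  exact h8.norm

theorem tsum_compTerm_eq_tsum_bSeriesAt
    (hg : ∀ l, ContDiff ℝ ((⊤ : ℕ∞) : WithTop ℕ∞) (g l)) (hx : φx none = 1)
    (h : BCompConverges g φx φy x₀) :
    ∑' p, compTerm g φx φy x₀ p = ∑' n, bSeriesAt g φy (bSeries g φx x₀) n := by
  classical
  -- Total degree n bounds the size of every tree and, nonempty trees having at least one vertex,
  -- the length of the tuple; each degree is therefore finite.
  let A : ℕ → Finset (T m × Σ r : ℕ, Fin r → NTree m) := fun n =>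
    ((Finset.range (n + 1)).biUnion (treesOfSize m) ×ˢ tuplesOf n (smallTrees m n)).filter
      fun p => size p.1 + ∑ j, (p.2.2 j).size = n
  rw [tsum_eq_tsum_sum_of_grading (summable_compTerm h)
    (fun p => size p.1 + ∑ j, (p.2.2 j).size) A]
  · refine tsum_congr fun n => ?_
    rw [bSeriesAt, ← Finset.sum_fiberwise_of_maps_to (t := Finset.HasAntidiagonal.antidiagonal n)
      (g := fun p : T m × Σ r : ℕ, Fin r → NTree m => (size p.1, ∑ j, (p.2.2 j).size)) fun p hp =>
        Finset.HasAntidiagonal.mem_antidiagonal.2 (Finset.mem_filter.1 hp).2]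
    refine Finset.sum_congr rfl fun q hq => ?_
    have hq' := Finset.HasAntidiagonal.mem_antidiagonal.1 hq
    have hA : (A n).filter (fun p => (size p.1, ∑ j, (p.2.2 j).size) = q) =
        treesOfSize m q.1 ×ˢ (tuplesOf n (smallTrees m n)).filter
          fun p => ∑ j, (p.2 j).size = q.2 := by
      ext p
      simp only [A, Finset.mem_filter, Finset.mem_product, Finset.mem_biUnion, Finset.mem_range,
        treesOfSize, Set.Finite.mem_toFinset, Set.mem_ofPred_eq, Prod.ext_iff]
      constructor
      · rintro ⟨⟨⟨-, h2⟩, -⟩, h3, h4⟩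
        exact ⟨h3, h2, h4⟩
      · rintro ⟨h3, h2, h4⟩
        exact ⟨⟨⟨⟨size p.1, by omega, rfl⟩, h2⟩, by omega⟩, h3, h4⟩
    rw [hA, Finset.sum_product]
    refine Finset.sum_congr rfl fun ϑ _ => ?_
    rw [formalSubst_bSeries_eq_sum_trees (contDiff_F hg ϑ) hx (by omega : q.2 ≤ n),
      Finset.smul_sum]
    rfl
  · intro n p
    simp only [A, Finset.mem_filter, Finset.mem_product, Finset.mem_biUnion, Finset.mem_range,
      treesOfSize, Set.Finite.mem_toFinset, Set.mem_ofPred_eq, mem_tuplesOf, mem_smallTrees]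
    refine ⟨fun h => h.2, fun h => ⟨⟨⟨size p.1, by omega, rfl⟩, ?_, fun i => ?_⟩, h⟩⟩
    · have : ∑ _j : Fin p.2.1, 1 ≤ ∑ j, (p.2.2 j).size :=
        Finset.sum_le_sum fun j _ => (p.2.2 j).size_pos
      simp only [Finset.sum_const, Finset.card_univ, Fintype.card_fin, smul_eq_mul, mul_one] at this
      omega
    · have := Finset.single_le_sum (f := fun j => (p.2.2 j).size) (fun _ _ => Nat.zero_le _)
        (Finset.mem_univ i)
      omega

/-- The B-series of the sum of a B-series, when all series converge. -/
theorem bSum_bSum (hg : ∀ l, ContDiff ℝ ((⊤ : ℕ∞) : WithTop ℕ∞) (g l))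
    (hga : ∀ l, AnalyticOnNhd ℝ (g l) Set.univ) (hx : φx none = 1) (hy : φy none = 0)
    (hc : BConverges g φx x₀) (h : BCompConverges g φx φy x₀)
    (hr : BConverges g (rcomp φx φy) x₀) :
    bSum g φy (bSum g φx x₀) = bSum g (rcomp φx φy) x₀ := by
  rw [← tsum_compTerm_eq_bSum hga hx hc h, tsum_compTerm_eq_tsum_bSeriesAt hg hx h,
    bSeriesAt_bSeries hg hx hy, bSum_eq_tsum_bSeries hr]

end Convergence
end StochB

/-! ### The lemma on simple iteration -/

open StochB in
theorem mainTheorem3 {d m : ℕ} {Ω : Type*} [MeasurableSpace Ω]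
    (P : MeasureTheory.Measure Ω) [MeasureTheory.IsProbabilityMeasure P]
    (g : Fin (m + 1) → EuclideanSpace ℝ (Fin d) → EuclideanSpace ℝ (Fin d))
    (hg : ∀ l, ContDiff ℝ ((⊤ : ℕ∞) : WithTop ℕ∞) (g l)) (x₀ : EuclideanSpace ℝ (Fin d))
    (Φex Φim Φ0 : Weight m Ω) (hex : IsWeight Φex) (him : IsWeight Φim) (h0 : IsWeight Φ0)
    (hex_empty : Φex none = 1) (him_empty : Φim none = 0) (h0_empty : Φ0 none = 1) :
    -- the functions `Φ_k` take values in the random variables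
    (∀ k, IsWeight (iterWeight Φex Φim Φ0 k)) ∧
    -- `Y_{1,k} = B(Φ_k, x₀; h)` as formal series
    (∀ Y : ℕ → ℝ≥0 → Ω → FormalSeries d,
      (∀ h ω, Y 0 h ω = bSeries g (fun τ => Φ0 τ h ω) x₀) →
      (∀ k h ω, Y (k + 1) h ω =
        bSeries g (fun τ => Φex τ h ω) x₀ + bSeriesAt g (fun τ => Φim τ h ω) (Y k h ω)) →
      ∀ k h ω, Y k h ω = bSeries g (fun τ => iterWeight Φex Φim Φ0 k τ h ω) x₀) ∧
    -- `Y_{1,k} = B(Φ_k, x₀; h)` as vectors in `ℝᵈ`, when the series converge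
    ((∀ l, AnalyticOnNhd ℝ (g l) Set.univ) → ∀ (h : ℝ≥0) (ω : Ω) (K : ℕ),
      BConverges g (fun τ => Φex τ h ω) x₀ →
      (∀ k ≤ K, BConverges g (fun τ => iterWeight Φex Φim Φ0 k τ h ω) x₀) →
      (∀ k < K, BCompConverges g (fun τ => iterWeight Φex Φim Φ0 k τ h ω)
        (fun τ => Φim τ h ω) x₀) →
      ∀ Y : ℕ → EuclideanSpace ℝ (Fin d),
        Y 0 = bSum g (fun τ => Φ0 τ h ω) x₀ →
        (∀ k, Y (k + 1) = bSum g (fun τ => Φex τ h ω) x₀ + bSum g (fun τ => Φim τ h ω) (Y k)) →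
        Y K = bSum g (fun τ => iterWeight Φex Φim Φ0 K τ h ω) x₀) ∧
    -- the height is the growth function
    (∃! Φ : Weight m Ω, IsNumericalWeight Φex Φim Φ) ∧
    (∀ Φ : Weight m Ω, IsNumericalWeight Φex Φim Φ →
      IsGrowthFunction height (iterWeight Φex Φim Φ0) Φ) ∧
    -- and it is sharp in general
    (∃ Ψex Ψim Ψ0 Ψ : Weight m Ω, IsWeight Ψex ∧ IsWeight Ψim ∧ IsWeight Ψ0 ∧
      Ψex none = 1 ∧ Ψim none = 0 ∧ Ψ0 none = 1 ∧ IsNumericalWeight Ψex Ψim Ψ ∧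
      ∀ τ k, k < height τ → iterWeight Ψex Ψim Ψ0 k τ ≠ Ψ τ) := by
  have hnone : ∀ k h ω, iterWeight Φex Φim Φ0 k none h ω = 1 := fun k h ω => by
    rw [iterWeight_none h0_empty]
    rfl
  have him_none : ∀ h ω, Φim none h ω = 0 := fun h ω => by
    rw [him_empty]
    rfl
  have hsucc : ∀ k h ω τ, iterWeight Φex Φim Φ0 (k + 1) τ h ω = Φex τ h ω +
      rcomp (fun τ => iterWeight Φex Φim Φ0 k τ h ω) (fun τ => Φim τ h ω) τ := fun k h ω τ => by
    rw [iterWeight_succ hex_empty him_empty]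
    rfl
  refine ⟨isWeight_iterWeight hex him h0, ?_, ?_,
    existsUnique_isNumericalWeight hex him hex_empty him_empty,
    fun Φ hΦ => isGrowthFunction_height him_empty hΦ, ?_⟩
  · intro Y hY0 hY k h ω
    induction k with
    | zero => exact hY0 h ω
    | succ k ih =>
      rw [hY, ih, bSeriesAt_bSeries hg (hnone k h ω) (him_none h ω)]
      funext n
      simp only [Pi.add_apply, bSeries, hsucc, ← Finset.sum_add_distrib, mul_add, add_smul]
  · intro hga h ω K hcex hc hcc Y hY0 hY
    induction K with
    | zero => exact hY0
    | succ K ih =>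
      have h1 := ih (fun k hk => hc k (by omega)) fun k hk => hcc k (by omega)
      have h2 := (hc (K + 1) le_rfl).sub hcex
      -- Convergence for the composed weights is not assumed: their series is the difference of
      -- those of Φ_{K+1} and Φ_ex.
      have hr : BConverges g (rcomp (fun τ => iterWeight Φex Φim Φ0 K τ h ω)
          (fun τ => Φim τ h ω)) x₀ :=
        h2.congr fun τ => by simp only [hsucc, mul_add, add_smul, add_sub_cancel_left]
      rw [hY, h1, bSum_bSum hg hga (hnone K h ω) (him_none h ω) (hc K (by omega))
        (hcc K (by omega)) hr]
      have h3 := hcex.tsum_add hr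
      rw [bSum, bSum, ← h3, bSum]
      exact tsum_congr fun τ => by rw [hsucc, mul_add, add_smul]
  · have : Nonempty Ω := MeasureTheory.nonempty_of_isProbabilityMeasure P
    exact exists_sharp
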